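/- Let $L^2=L^2(\mathbb T,m)$ with $m$ normalized Lebesgue measure on the unit circle, let $H^2\subset L^2$ be the Hardy space, and for an inner function $\theta$ put $K_\theta=H^2\ominus\theta H^2$, $P_\theta$ the orthogonal projection of $L^2$ onto $K_\theta$, and $C_\theta f=\theta\bar z\bar f$ for $f\in L^2$. A conjugation on a complex Hilbert space is an antilinear involution $C$ with $\langle Cf,Cg\rangle=\langle g,f\rangle$ for all $f,g$. Let $\alpha,\theta$ be nonconstant inner functions such that $\alpha$ divides $\theta$, i.e. $\theta/\alpha$ is an inner function (possibly constant), so that $K_\theta=K_\alpha\oplus\alpha K_{\theta/\alpha}$. Let $\tilde C$ be a conjugation on $K_\theta$, and assume that there are conjugations $C_1,C_2$ on $L^2$ with $M_zC_i=C_iM_{\bar z}$ ($i=1,2$), where $M_\varphi f=\varphi f$, such that $\tilde C|_{K_\alpha}=C_1|_{K_\alpha}$ and $\tilde C|_{K_\theta\ominus K_\alpha}=C_2|_{K_\theta\ominus K_\alpha}$. Then, up to unimodular constants, $\tilde C$ is $C_\theta$ or $C_{\alpha,\theta/\alpha}=C_\alpha\oplus\alpha C_{\theta/\alpha}\bar\alpha$;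 precisely, one of the following holds: (i) there is $c\in\mathbb C$ with $|c|=1$ such that $\tilde C f=c\,C_\theta f$ for all $f\in K_\theta$; (ii) there are $c_1,c_2\in\mathbb C$ with $|c_1|=|c_2|=1$ such that $\tilde C=c_1C_\alpha\oplus c_2\,\alpha C_{\theta/\alpha}\bar\alpha$, i.e. $\tilde C f=c_1C_\alpha P_\alpha f+c_2\,\alpha C_{\theta/\alpha}P_{\theta/\alpha}(\bar\alpha f)$ for all $f\in K_\theta$. -/

import Mathlib

open MeasureTheory AddCircle Filter Topology
open scoped ENNReal ComplexConjugate InnerProductSpace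

noncomputable section

namespace ModelSpace

/-- Normalized Lebesgue measure `m` on the unit circle; the point `t : UnitAddCircle = ℝ / ℤ`
stands for the point `e^{2 π i t}` of the unit circle, which is `toCircle t`. -/
abbrev circleMeasure : Measure UnitAddCircle := haarAddCircle

/-- The space `L² = L²(𝕋, m)`. -/
abbrev L2 : Type := Lp ℂ 2 circleMeasure

/-- The space `L^∞ = L^∞(𝕋, m)`. -/
abbrev LInf : Type := Lp ℂ ∞ circleMeasure

/-- The multiplication operator `M_φ f = φ f` on `L²`, for `φ ∈ L^∞`. -/
def mulOp (φ : LInf) : L2 →ₗ[ℂ] L2 where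
  toFun f := φ • f
  map_add' f g := Lp.add_smul φ f g
  map_smul' c f := (Lp.smul_comm c φ f).symm

/-- The function `z` on the unit circle, as an element of `L^∞`. -/
def zFun : LInf := fourierLp ∞ 1

/-- A conjugation on a complex inner product space: an antilinear involution `C` with
`⟪C f, C g⟫ = ⟪g, f⟫`. -/
structure IsConjugation {H : Type*} [NormedAddCommGroup H] [InnerProductSpace ℂ H]
    (C : H →ₗ⋆[ℂ] H) : Prop where
  involutive : ∀ f, C (C f) = f
  inner_map : ∀ f g, ⟪C f, C g⟫_ℂ = ⟪g, f⟫_ℂ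

/-- An `M_z`-conjugation: a conjugation `C` on `L²` with `M_z C = C M_{z̄}`. -/
structure IsMzConjugation (C : L2 →ₗ⋆[ℂ] L2) : Prop extends IsConjugation C where
  mul_comm : ∀ f, mulOp zFun (C f) = C (mulOp (star zFun) f)

/-- The Hardy space `H²`, as a subspace of `L²`: the functions whose Fourier coefficients of
negative index vanish. -/
def hardy : Submodule ℂ L2 where
  carrier := {f | ∀ n : ℤ, n < 0 → fourierCoeff f n = 0}
  add_mem' {f g} hf hg n hn := by
    have h1 := hf n hn
    have h2 := hg n hn
    rw [← fourierBasis_repr] at h1 h2 ⊢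
    simp [h1, h2]
  zero_mem' n _ := by
    rw [← fourierBasis_repr]
    simp
  smul_mem' c f hf n hn := by
    have h1 := hf n hn
    rw [← fourierBasis_repr] at h1 ⊢
    simp [h1]

lemma isClosed_hardy : IsClosed (hardy : Set L2) := by
  have h : (hardy : Set L2)
      = ⋂ n : ℤ, ⋂ _ : n < 0, {f : L2 | ⟪(fourierLp 2 n : L2), f⟫_ℂ = 0} := by
    ext f
    simp only [Set.mem_iInter, Set.mem_ofPred_eq]
    refine forall₂_congr fun n _ => ?_
    rw [← fourierBasis_repr, HilbertBasis.repr_apply_apply, coe_fourierBasis]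
  rw [h]
  exact isClosed_iInter fun n => isClosed_iInter fun _ =>
    isClosed_eq (by fun_prop) continuous_const

/-- An inner function: a bounded analytic function on the open unit disc whose radial boundary
values exist and have modulus one at almost every point of the circle. (The values of the
underlying function outside the disc are irrelevant.) -/
structure InnerFunction where
  toFun : ℂ → ℂ
  differentiableOn : DifferentiableOn ℂ toFun (Metric.ball 0 1)
  bounded : ∃ M : ℝ, ∀ z ∈ Metric.ball (0 : ℂ) 1, ‖toFun z‖ ≤ M
  boundary : ∀ᵐ t ∂circleMeasure, ∃ w : ℂ, ‖w‖ = 1 ∧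
    Tendsto (fun r : ℝ => toFun (r * toCircle t)) (𝓝[<] 1) (𝓝 w)

namespace InnerFunction

/-- The inner function is constant on the disc. -/
def IsConstant (θ : InnerFunction) : Prop :=
  ∃ c : ℂ, ∀ z ∈ Metric.ball (0 : ℂ) 1, θ.toFun z = c

/-- `β` is the quotient `θ / α` of inner functions: `θ = α β` on the disc. The inner function `α`
divides `θ` when such an inner function `β` exists. -/
def IsQuotient (θ α β : InnerFunction) : Prop :=
  ∀ z ∈ Metric.ball (0 : ℂ) 1, θ.toFun z = α.toFun z * β.toFun z

/-- The radial boundary values `lim_{r → 1-} θ(r e^{2 π i t})`. -/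
def boundaryFun (θ : InnerFunction) (t : UnitAddCircle) : ℂ :=
  limUnder (𝓝[<] (1 : ℝ)) fun r : ℝ => θ.toFun (r * toCircle t)

lemma ae_tendsto (θ : InnerFunction) : ∀ᵐ t ∂circleMeasure, ‖θ.boundaryFun t‖ = 1 ∧
    Tendsto (fun r : ℝ => θ.toFun (r * toCircle t)) (𝓝[<] 1) (𝓝 (θ.boundaryFun t)) := by
  filter_upwards [θ.boundary] with t ⟨w, hw, ht⟩
  have h : θ.boundaryFun t = w := ht.limUnder_eq
  rw [h]
  exact ⟨hw, ht⟩

lemma memLp_boundaryFun (θ : InnerFunction) : MemLp θ.boundaryFun ∞ circleMeasure := by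
  obtain ⟨u, -, hu, hu1⟩ := exists_seq_strictMono_tendsto' (show (0 : ℝ) < 1 by norm_num)
  have hlim : Tendsto u atTop (𝓝[<] 1) :=
    tendsto_nhdsWithin_iff.2 ⟨hu1, Eventually.of_forall fun n => (hu n).2⟩
  have hmeas : AEStronglyMeasurable θ.boundaryFun circleMeasure := by
    refine aestronglyMeasurable_of_tendsto_ae atTop
      (f := fun n t => θ.toFun (u n * toCircle t)) (fun n => ?_) ?_
    · refine (θ.differentiableOn.continuousOn.comp_continuous
        (by fun_prop) fun t => ?_).aestronglyMeasurable
      have h1 : ‖((toCircle t : Circle) : ℂ)‖ = 1 := Circle.norm_coe _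
      rw [mem_ball_zero_iff, norm_mul, h1, mul_one, Complex.norm_real, Real.norm_eq_abs,
        abs_of_pos (hu n).1]
      exact (hu n).2
    · filter_upwards [θ.ae_tendsto] with t ht using ht.2.comp hlim
  refine memLp_top_of_bound hmeas 1 ?_
  filter_upwards [θ.ae_tendsto] with t ht using ht.1.le

/-- The boundary function of an inner function, as an element of `L^∞`. -/
def bdry (θ : InnerFunction) : LInf := θ.memLp_boundaryFun.toLp θ.boundaryFun

end InnerFunction

/-- The model space `K_θ = H² ⊖ θ H²`, as a subspace of `L²`. -/
def modelSpace (θ : InnerFunction) : Submodule ℂ L2 :=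
  hardy ⊓ (hardy.map (mulOp θ.bdry))ᗮ

instance (θ : InnerFunction) : CompleteSpace (modelSpace θ) :=
  (isClosed_hardy.inter (Submodule.isClosed_orthogonal _)).completeSpace_coe

/-- The orthogonal projection `P_θ` of `L²` onto `K_θ`. -/
def proj (θ : InnerFunction) (f : L2) : L2 := (modelSpace θ).starProjection f

/-- The map `C_θ f = θ z̄ f̄` on `L²`. -/
def modelConj (θ : InnerFunction) (f : L2) : L2 :=
  mulOp θ.bdry (mulOp (star zFun) (star f))

/-- The map `A ⊕ α B ᾱ`, i.e. `g₁ + α g₂ ↦ A g₁ + α B g₂` for `g₁ ∈ K_α` and `g₂ ∈ K_β`; the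
components of `f = g₁ + α g₂` are `g₁ = P_α f` and `g₂ = P_β (ᾱ f)`.
For `A = C_α` and `B = C_β` it is the conjugation `C_{α,β}`. -/
def directSumMap (α β : InnerFunction) (A B : L2 → L2) (f : L2) : L2 :=
  A (proj α f) + mulOp α.bdry (B (proj β (mulOp (star α.bdry) f)))

end ModelSpace

end

/-! Write `A`, `B` for the boundary functions of `α`, `β`, so that `A B` is that of `θ`. An
`M_z`-conjugation is determined by its value `ψ` at the constant `1`: it is `f ↦ ψ f̄` with `ψ`
unimodular (`IsMzConjugation.exists_unimodular`). Hence the given conjugation `D` is `F ↦ ψ₁ F̄` on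
`K_A` and `F ↦ ψ₂ F̄` on `A K_B`.

Composing with `C_{AB}` removes the antilinearity. The unitary `C_{AB} D` of `K_{AB}` sends `F + A
G` to `u F + v G`, where `u = A B z̄ ψ̄₁` and `v = A B z̄ ψ̄₂ A`; thus `K_{AB} = u K_A ⊕ v K_B`. The
task is to show that this is one of the two obvious decompositions.

The main tool is the reproducing kernel at the origin, `k_u = 1 - conj (u(0)) u`. It is outer for
nonconstant inner `u`, so it may be cancelled from a product lying in `H²` (`Hardy.of_ker_mul`).
Applied to `k_A` and to `C_A k_A`, this shows that `u` is inner and divides `B`; in the same way `v`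
is inner and divides `A` (`hardy_of_mul_model`). Testing the decomposition on elements of `K_{AB}`
orthogonal to `u K_A` or `v K_B` shows that one of `u`, `v` is constant, and that the other is then
a constant multiple of `B` or `A` respectively (`hardy_star_of_complement`, `eq_cst_of_complement`).

If `v` is constant, then `u` is a multiple of `B` and `D` is the direct sum. Otherwise `u` is
constant, `v` is a multiple of `A`, and `D` is `a C_{AB}` on `K_A` and `b C_{AB}` on `A K_B`; the
identity `D² = 1` forces `a = b`. -/

noncomputable section

namespace ModelSpace

/-! ### The star ring of measurable functions modulo null sets. -/

/-- Complex measurable functions on the circle, up to equality almost everywhere. -/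
abbrev Germ : Type := UnitAddCircle →ₘ[circleMeasure] ℂ

namespace Germ

/-- Products of `L²` functions leave `L²`. In this ring all products make sense, and the identities
between `A`, `B`, `z`, `ψ` and their conjugates follow by `linear_combination` from relations `star
u * u = 1`; integrability is tracked separately. -/
instance : CommRing Germ where
  __ := (inferInstance : AddCommGroup Germ)
  __ := (inferInstance : CommMonoid Germ)
  left_distrib f g h := by
    ext1
    filter_upwards [AEEqFun.coeFn_mul f (g + h), AEEqFun.coeFn_add g h,
      AEEqFun.coeFn_add (f * g) (f * h), AEEqFun.coeFn_mul f g, AEEqFun.coeFn_mul f h]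
      with t h1 h2 h3 h4 h5
    simp only [h1, h2, h3, h4, h5, Pi.mul_apply, Pi.add_apply, mul_add]
  right_distrib f g h := by
    ext1
    filter_upwards [AEEqFun.coeFn_mul (f + g) h, AEEqFun.coeFn_add f g,
      AEEqFun.coeFn_add (f * h) (g * h), AEEqFun.coeFn_mul f h, AEEqFun.coeFn_mul g h]
      with t h1 h2 h3 h4 h5
    simp only [h1, h2, h3, h4, h5, Pi.mul_apply, Pi.add_apply, add_mul]
  zero_mul f := by
    ext1
    filter_upwards [AEEqFun.coeFn_mul 0 f, AEEqFun.coeFn_zero (μ := circleMeasure) (β := ℂ)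
      (α := UnitAddCircle)] with t h1 h2
    simp [h1, h2]
  mul_zero f := by
    ext1
    filter_upwards [AEEqFun.coeFn_mul f 0, AEEqFun.coeFn_zero (μ := circleMeasure) (β := ℂ)
      (α := UnitAddCircle)] with t h1 h2
    simp [h1, h2]

instance : StarRing Germ where
  star_mul f g := by
    ext1
    filter_upwards [AEEqFun.coeFn_star (f * g), AEEqFun.coeFn_mul f g,
      AEEqFun.coeFn_mul (star g) (star f), AEEqFun.coeFn_star f, AEEqFun.coeFn_star g]
      with t h1 h2 h3 h4 h5
    simp [h1, h2, h3, h4, h5]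
    exact mul_comm _ _
  star_add f g := by
    ext1
    filter_upwards [AEEqFun.coeFn_star (f + g), AEEqFun.coeFn_add f g,
      AEEqFun.coeFn_add (star f) (star g), AEEqFun.coeFn_star f, AEEqFun.coeFn_star g]
      with t h1 h2 h3 h4 h5
    simp [h1, h2, h3, h4, h5]

/-- The constant functions. -/
def cst : ℂ →+* Germ where
  toFun c := AEEqFun.const _ c
  map_one' := rfl
  map_zero' := rfl
  map_mul' _ _ := (AEEqFun.mk_mul_mk _ _ _ _).symm
  map_add' _ _ := (AEEqFun.mk_add_mk _ _ _ _).symm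

lemma coeFn_cst (c : ℂ) : ⇑(cst c) =ᵐ[circleMeasure] fun _ => c :=
  AEEqFun.coeFn_const _ c

lemma star_cst (c : ℂ) : star (cst c) = cst (conj c) := by
  ext1
  filter_upwards [AEEqFun.coeFn_star (cst c), coeFn_cst c, coeFn_cst (conj c)] with t h1 h2 h3
  simp [h1, h2, h3]

lemma smul_eq_cst_mul (c : ℂ) (F : Germ) : c • F = cst c * F := by
  ext1
  filter_upwards [AEEqFun.coeFn_smul c F, AEEqFun.coeFn_mul (cst c) F, coeFn_cst c] with t h1 h2 h3
  simp [h1, h2, h3]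

lemma cst_injective : Function.Injective cst := fun a b h => by
  have h1 : (fun _ : UnitAddCircle => a) =ᵐ[circleMeasure] fun _ => b :=
    (coeFn_cst a).symm.trans ((AEEqFun.ext_iff.1 h).trans (coeFn_cst b))
  exact h1.exists.choose_spec

instance : Nontrivial Germ := cst_injective.nontrivial

/-- Unimodular functions. -/
def Unimodular (u : Germ) : Prop := star u * u = 1

lemma Unimodular.mul {u v : Germ} (hu : u.Unimodular) (hv : v.Unimodular) :
    Unimodular (u * v) := by
  unfold Unimodular at *
  rw [star_mul]
  linear_combination star v * v * hu + hv

lemma Unimodular.unimodular_star {u : Germ} (hu : u.Unimodular) : Unimodular (star u) := by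
  unfold Unimodular at *
  rw [star_star, mul_comm, hu]

lemma unimodular_iff {u : Germ} :
    u.Unimodular ↔ ∀ᵐ t ∂circleMeasure, ‖u t‖ = 1 := by
  have key : ∀ z : ℂ, conj z * z = 1 ↔ ‖z‖ = 1 := fun z => by
    rw [Complex.conj_mul']
    norm_cast
    exact pow_eq_one_iff_of_nonneg (norm_nonneg z) two_ne_zero
  unfold Unimodular
  rw [AEEqFun.ext_iff]
  refine ⟨fun h => ?_, fun h => ?_⟩
  · filter_upwards [h, AEEqFun.coeFn_mul (star u) u, AEEqFun.coeFn_star u,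
      AEEqFun.coeFn_one (μ := circleMeasure) (β := ℂ) (α := UnitAddCircle)] with t h1 h2 h3 h4
    rw [← key]
    simpa [h2, h3, h4] using h1
  · filter_upwards [h, AEEqFun.coeFn_mul (star u) u, AEEqFun.coeFn_star u,
      AEEqFun.coeFn_one (μ := circleMeasure) (β := ℂ) (α := UnitAddCircle)] with t h1 h2 h3 h4
    rw [← key] at h1
    simpa [h2, h3, h4] using h1

lemma Unimodular.norm_eq {u : Germ} (hu : u.Unimodular) {c : ℂ} (h : u = cst c) : ‖c‖ = 1 := by
  have h1 : cst (conj c * c) = cst 1 := by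
    rw [map_mul, map_one, ← star_cst, ← h]
    exact hu
  have h2 := cst_injective h1
  rw [Complex.conj_mul'] at h2
  norm_cast at h2
  exact (pow_eq_one_iff_of_nonneg (norm_nonneg c) two_ne_zero).1 h2

/-! ### Integrals and square integrable functions. -/

/-- The integral of a function over the circle. -/
def integral (F : Germ) : ℂ := ∫ t, F t ∂circleMeasure

lemma integral_star (F : Germ) : (star F).integral = conj F.integral := by
  unfold integral
  rw [← integral_conj]
  exact integral_congr_ae (by filter_upwards [AEEqFun.coeFn_star F] with t h using by simp [h])

lemma integral_cst_mul (c : ℂ) (F : Germ) : (cst c * F).integral = c * F.integral := by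
  unfold integral
  rw [← MeasureTheory.integral_const_mul]
  exact integral_congr_ae (by
    filter_upwards [AEEqFun.coeFn_mul (cst c) F, coeFn_cst c] with t h h' using by simp [h, h'])

lemma integral_cst (c : ℂ) : (cst c).integral = c := by
  unfold integral
  rw [integral_congr_ae (coeFn_cst c)]
  simp

/-- Square integrable functions, as germs. -/
def SqInt (F : Germ) : Prop := F ∈ Lp ℂ 2 circleMeasure

lemma sqInt_coe (f : L2) : SqInt (f : Germ) := f.2

lemma SqInt.memLp {F : Germ} (hF : F.SqInt) : MemLp F 2 circleMeasure := Lp.mem_Lp_iff_memLp.1 hF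

lemma sqInt_of_memLp {F : Germ} (hF : MemLp F 2 circleMeasure) : F.SqInt := Lp.mem_Lp_iff_memLp.2 hF

lemma SqInt.add {F G : Germ} (hF : F.SqInt) (hG : G.SqInt) : (F + G).SqInt := add_mem hF hG

lemma SqInt.sub {F G : Germ} (hF : F.SqInt) (hG : G.SqInt) : (F - G).SqInt := sub_mem hF hG

lemma SqInt.sqInt_star {F : Germ} (hF : F.SqInt) : (star F).SqInt :=
  (star (⟨F, hF⟩ : L2)).2

lemma Unimodular.memLp_top {u : Germ} (hu : u.Unimodular) : MemLp u ∞ circleMeasure :=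
  memLp_top_of_bound u.aestronglyMeasurable 1
    (by filter_upwards [unimodular_iff.1 hu] with t h using h.le)

lemma SqInt.unimodular_mul {u F : Germ} (hF : F.SqInt) (hu : u.Unimodular) : (u * F).SqInt :=
  sqInt_of_memLp ((hF.memLp.mul (p := ∞) (r := 2) hu.memLp_top).ae_eq (AEEqFun.coeFn_mul u F).symm)

lemma sqInt_cst (c : ℂ) : (cst c).SqInt :=
  sqInt_of_memLp ((memLp_const c).ae_eq (coeFn_cst c).symm)

lemma SqInt.cst_mul {F : Germ} (c : ℂ) (hF : F.SqInt) : (cst c * F).SqInt := by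
  rw [← smul_eq_cst_mul]
  exact (c • (⟨F, hF⟩ : L2)).2

lemma Unimodular.sqInt {u : Germ} (hu : u.Unimodular) : u.SqInt := by
  simpa using (sqInt_cst 1).unimodular_mul hu

lemma SqInt.integrable_mul {F G : Germ} (hF : F.SqInt) (hG : G.SqInt) :
    Integrable (F * G : Germ) circleMeasure :=
  (hF.memLp.integrable_mul hG.memLp).congr (AEEqFun.coeFn_mul F G).symm

lemma SqInt.integrable {F : Germ} (hF : F.SqInt) : Integrable F circleMeasure := by
  simpa using hF.integrable_mul (G := 1) (by simpa using sqInt_cst 1)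

lemma integral_add {F G : Germ} (hF : Integrable F circleMeasure)
    (hG : Integrable G circleMeasure) : (F + G).integral = F.integral + G.integral := by
  unfold integral
  rw [← MeasureTheory.integral_add hF hG]
  exact integral_congr_ae (AEEqFun.coeFn_add F G)

lemma integral_sub {F G : Germ} (hF : Integrable F circleMeasure)
    (hG : Integrable G circleMeasure) : (F - G).integral = F.integral - G.integral := by
  unfold integral
  rw [← MeasureTheory.integral_sub hF hG]
  exact integral_congr_ae (AEEqFun.coeFn_sub F G)

lemma integral_star_mul_coe (f g : L2) : integral (star (f : Germ) * (g : Germ)) = ⟪f, g⟫_ℂ := by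
  rw [L2.inner_def]
  unfold integral
  refine integral_congr_ae ?_
  filter_upwards [AEEqFun.coeFn_mul (star (f : Germ)) g, AEEqFun.coeFn_star (f : Germ)] with t h1 h2
  simp [h1, h2]
  exact mul_comm _ _

lemma eq_zero_of_integral_star_mul_self {F : Germ} (hF : F.SqInt)
    (h : (star F * F).integral = 0) : F = 0 := by
  have h1 := integral_star_mul_coe ⟨F, hF⟩ ⟨F, hF⟩
  rw [h, eq_comm, inner_self_eq_zero] at h1
  exact congrArg Subtype.val h1

lemma norm_integral_unimodular_mul_le {u F : Germ} (hu : u.Unimodular) :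
    ‖(u * F).integral‖ ≤ ∫ t, ‖F t‖ ∂circleMeasure := by
  refine (norm_integral_le_integral_norm _).trans_eq (integral_congr_ae ?_)
  filter_upwards [AEEqFun.coeFn_mul u F, unimodular_iff.1 hu] with t h1 h2
  simp [h1, h2]

/-! ### The Hardy space and its orthogonal complement. -/

/-- The function `z` on the circle. -/
def z : Germ := (zFun : Germ)

lemma coeFn_z : ⇑z =ᵐ[circleMeasure] fun t => fourier 1 t := coeFn_fourierLp ∞ 1

lemma unimodular_z : z.Unimodular := by
  rw [unimodular_iff]
  filter_upwards [coeFn_z] with t h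
  rw [h, fourier_one, Circle.norm_coe]

lemma coeFn_z_pow (n : ℕ) : ⇑(z ^ n) =ᵐ[circleMeasure] fun t => fourier n t := by
  induction n with
  | zero => simpa [fourier_zero] using coeFn_cst 1
  | succ n ih =>
    rw [pow_succ]
    filter_upwards [AEEqFun.coeFn_mul (z ^ n) z, ih, coeFn_z] with t h1 h2 h3
    rw [h1, Pi.mul_apply, h2, h3]
    push_cast
    rw [fourier_add]

lemma coe_fourierLp (n : ℕ) : ((fourierLp 2 (n : ℤ) : L2) : Germ) = z ^ n := by
  ext1
  exact (coeFn_fourierLp 2 _).trans (coeFn_z_pow n).symm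

lemma coe_fourierLp_neg (n : ℕ) : ((fourierLp 2 (-n : ℤ) : L2) : Germ) = star (z ^ n) := by
  ext1
  filter_upwards [coeFn_fourierLp (T := 1) 2 (-n : ℤ), AEEqFun.coeFn_star (z ^ n),
    coeFn_z_pow n] with t h1 h2 h3
  rw [h1, h2, Pi.star_apply, h3, fourier_neg]
  rfl

lemma Unimodular.pow {u : Germ} (hu : u.Unimodular) (n : ℕ) : Unimodular (u ^ n) := by
  induction n with
  | zero => simp [Unimodular]
  | succ n ih => rw [pow_succ]; exact ih.mul hu

/-- The Hardy space, as a set of germs. -/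
def Hardy (F : Germ) : Prop := F.SqInt ∧ ∀ n : ℕ, (z ^ (n + 1) * F).integral = 0

lemma fourierCoeff_eq_integral (f : L2) (n : ℕ) :
    fourierCoeff f (-n : ℤ) = (z ^ n * (f : Germ)).integral := by
  rw [fourierCoeff, neg_neg]
  refine integral_congr_ae ?_
  filter_upwards [AEEqFun.coeFn_mul (z ^ n) (f : Germ), coeFn_z_pow n] with t h1 h2
  simp [h1, h2]

lemma hardy_coe_iff (f : L2) : Hardy (f : Germ) ↔ f ∈ hardy := by
  refine ⟨fun h n hn => ?_, fun h => ⟨f.2, fun n => ?_⟩⟩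
  · obtain ⟨m, rfl⟩ : ∃ m : ℕ, n = -((m + 1 : ℕ) : ℤ) := ⟨(-n - 1).toNat, by omega⟩
    rw [fourierCoeff_eq_integral]
    exact h.2 m
  · rw [← fourierCoeff_eq_integral]
    exact h _ (by push_cast; omega)

namespace Hardy

lemma sqInt {F : Germ} (hF : Hardy F) : F.SqInt := hF.1

lemma add {F G : Germ} (hF : Hardy F) (hG : Hardy G) : Hardy (F + G) := by
  refine ⟨hF.1.add hG.1, fun n => ?_⟩
  rw [mul_add, integral_add, hF.2, hG.2, add_zero]
  · exact (hF.1.unimodular_mul (unimodular_z.pow _)).integrable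
  · exact (hG.1.unimodular_mul (unimodular_z.pow _)).integrable

lemma cst_mul {F : Germ} (c : ℂ) (hF : Hardy F) : Hardy (cst c * F) := by
  refine ⟨hF.1.cst_mul c, fun n => ?_⟩
  rw [mul_left_comm, integral_cst_mul, hF.2, mul_zero]

lemma neg {F : Germ} (hF : Hardy F) : Hardy (-F) := by
  simpa using hF.cst_mul (-1)

lemma sub {F G : Germ} (hF : Hardy F) (hG : Hardy G) : Hardy (F - G) := by
  rw [sub_eq_add_neg]
  exact hF.add hG.neg

end Hardy

lemma integral_star_z_pow_mul_z_pow (m n : ℕ) :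
    integral (star (z ^ m) * z ^ n) = if m = n then 1 else 0 := by
  have h := orthonormal_iff_ite.1 (orthonormal_fourier (T := 1)) m n
  rw [← integral_star_mul_coe, coe_fourierLp, coe_fourierLp] at h
  rw [h]
  simp

lemma integral_z_pow_succ (n : ℕ) : (z ^ (n + 1)).integral = 0 := by
  simpa using integral_star_z_pow_mul_z_pow 0 (n + 1)

lemma hardy_one : Hardy 1 :=
  ⟨by simpa using sqInt_cst 1, fun n => by rw [mul_one]; exact integral_z_pow_succ n⟩

lemma hardy_cst (c : ℂ) : Hardy (cst c) := by simpa using hardy_one.cst_mul c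

/-- Products of functions in the Hardy space have vanishing negative Fourier coefficients. -/
lemma Hardy.integral_mul {F G : Germ} (hF : Hardy F) (hG : Hardy G) (n : ℕ) :
    (z ^ (n + 1) * (F * G)).integral = 0 := by
  -- The product is only integrable, so its coefficient is computed by Parseval as `⟪x, y⟫`: `x` has
  -- no frequencies `i ≥ 0` and `y` none with `i < 0`, so every term vanishes.
  set x : L2 := ⟨star (z ^ (n + 1) * F), (hF.1.unimodular_mul (unimodular_z.pow _)).sqInt_star⟩ with hx
  set y : L2 := ⟨G, hG.1⟩ with hy
  have h := fourierBasis.hasSum_inner_mul_inner x y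
  have hxy : ⟪x, y⟫_ℂ = (z ^ (n + 1) * (F * G)).integral := by
    rw [← integral_star_mul_coe, hx, hy]
    simp only [star_star, mul_assoc]
  rw [← hxy]
  refine h.unique ?_
  refine (hasSum_zero (α := ℂ) (β := ℤ)).congr_fun ?_
  intro i
  rw [coe_fourierBasis]
  rcases lt_or_ge i 0 with hi | hi
  · obtain ⟨m, rfl⟩ : ∃ m : ℕ, i = -((m + 1 : ℕ) : ℤ) := ⟨(-i - 1).toNat, by omega⟩
    rw [← integral_star_mul_coe _ y, coe_fourierLp_neg, star_star]
    simp only [hy]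
    rw [hG.2, mul_zero]
  · obtain ⟨m, rfl⟩ : ∃ m : ℕ, i = m := ⟨i.toNat, by omega⟩
    rw [← integral_star_mul_coe x, coe_fourierLp]
    simp only [hx, star_star]
    rw [show z ^ (n + 1) * F * z ^ m = z ^ (n + m + 1) * F by ring, hF.2, zero_mul]

lemma Hardy.unimodular_mul {u F : Germ} (hF : Hardy F) (hu : u.Unimodular) (hu' : Hardy u) :
    Hardy (u * F) :=
  ⟨hF.1.unimodular_mul hu, hu'.integral_mul hF⟩

lemma eq_zero_of_integral_eq_zero {F : Germ} (hF : F.SqInt)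
    (h1 : ∀ n : ℕ, (z ^ n * F).integral = 0)
    (h2 : ∀ n : ℕ, (star (z ^ n) * F).integral = 0) : F = 0 := by
  set f : L2 := ⟨F, hF⟩ with hf
  have h : fourierBasis.repr f = 0 := by
    ext i
    rw [HilbertBasis.repr_apply_apply, coe_fourierBasis, ← integral_star_mul_coe]
    rcases le_or_gt i 0 with hi | hi
    · obtain ⟨m, rfl⟩ : ∃ m : ℕ, i = -(m : ℤ) := ⟨(-i).toNat, by omega⟩
      rw [coe_fourierLp_neg, star_star]
      exact h1 m
    · obtain ⟨m, rfl⟩ : ∃ m : ℕ, i = m := ⟨i.toNat, by omega⟩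
      rw [coe_fourierLp]
      exact h2 m
  exact congrArg Subtype.val ((map_eq_zero_iff _ fourierBasis.repr.injective).1 h)

/-- A function such that it and its complex conjugate are in the Hardy space is constant. -/
lemma Hardy.eq_cst {F : Germ} (hF : Hardy F) (hF' : Hardy (star F)) : F = cst F.integral := by
  rw [← sub_eq_zero]
  have h1 := hF.sub (hardy_cst F.integral)
  have h2 := hF'.sub (hardy_cst (conj F.integral))
  have h0 : (F - cst F.integral).integral = 0 := by
    rw [integral_sub hF.1.integrable (sqInt_cst _).integrable, integral_cst, sub_self]
  refine eq_zero_of_integral_eq_zero h1.1 (fun n => ?_) fun n => ?_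
  · cases n with
    | zero => simpa using h0
    | succ n => exact h1.2 n
  · cases n with
    | zero => simpa using h0
    | succ n =>
      have h3 := h2.2 n
      rw [← star_cst, ← star_sub] at h3
      rw [← star_star (F - cst F.integral), ← star_mul, mul_comm, integral_star, h3, map_zero]

/-- The functions orthogonal to the Hardy space are the functions `z̄ h̄` with `h` in the Hardy
space. -/
lemma hardy_star_z_mul_star {F : Germ} (hF : F.SqInt)
    (h : ∀ n : ℕ, (star (z ^ n) * F).integral = 0) : Hardy (star z * star F) := by
  refine ⟨hF.sqInt_star.unimodular_mul unimodular_z.unimodular_star, fun n => ?_⟩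
  have hz := unimodular_z
  unfold Unimodular at hz
  rw [show z ^ (n + 1) * (star z * star F) = star (star (z ^ n) * F) by
    rw [star_mul, star_star]; linear_combination z ^ n * star F * hz, integral_star, h, map_zero]

/-- Functions `z̄ h̄` with `h ∈ H²` are orthogonal to `H²`: the conjugate of the integral is that of
`z` times a product of two Hardy functions. -/
lemma Hardy.integral_star_mul {F G : Germ} (hG : Hardy G) (hF : Hardy (star z * star F)) :
    integral (star G * F) = 0 := by
  have h := hF.integral_mul hG 0
  have hz := unimodular_z
  unfold Unimodular at hz
  rw [show z ^ (0 + 1) * (star z * star F * G) = star (star G * F) by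
    rw [star_mul, star_star]; linear_combination star F * G * hz, integral_star] at h
  simpa using h

lemma integral_star_mul_comm (F G : Germ) :
    integral (star F * G) = conj (integral (star G * F)) := by
  rw [← integral_star, star_mul, star_star]

lemma hardy_backward_shift {F : Germ} (hF : Hardy F) :
    Hardy (star z * (F - cst F.integral)) := by
  have hz := unimodular_z
  unfold Unimodular at hz
  have h1 := hF.sub (hardy_cst F.integral)
  refine ⟨h1.1.unimodular_mul unimodular_z.unimodular_star, fun n => ?_⟩
  rw [show z ^ (n + 1) * (star z * (F - cst F.integral)) = z ^ n * (F - cst F.integral) by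
    linear_combination z ^ n * (F - cst F.integral) * hz]
  cases n with
  | zero =>
    rw [pow_zero, one_mul, integral_sub hF.1.integrable (sqInt_cst _).integrable, integral_cst,
      sub_self]
  | succ n => exact h1.2 n

/-- A square integrable function is the sum of a function in the Hardy space and an orthogonal
one. -/
lemma SqInt.exists_hardy_add {F : Germ} (hF : F.SqInt) :
    ∃ G M : Germ, F = G + M ∧ Hardy G ∧ M.SqInt ∧ Hardy (star z * star M) := by
  have : CompleteSpace hardy := isClosed_hardy.completeSpace_coe
  set f : L2 := ⟨F, hF⟩
  set g : L2 := hardy.starProjection f with hg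
  have hg' : g ∈ hardy := Submodule.starProjection_apply_mem _ _
  have ho : f - g ∈ hardyᗮ := Submodule.sub_starProjection_mem_orthogonal f
  refine ⟨g, (f - g : L2), ?_, (hardy_coe_iff g).2 hg', (f - g).2,
    hardy_star_z_mul_star (f - g).2 fun n => ?_⟩
  · rw [AddSubgroupClass.coe_sub]
    ring
  · rw [← coe_fourierLp, integral_star_mul_coe]
    refine ho _ ((hardy_coe_iff _).1 ?_)
    rw [coe_fourierLp]
    exact ⟨(unimodular_z.pow _).sqInt, fun m => by
      rw [← pow_add, add_right_comm]; exact integral_z_pow_succ _⟩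

/-! ### Reproducing kernels at the origin. -/

/-- The function has no constant representative. -/
def NonConst (u : Germ) : Prop := ∀ c : ℂ, u ≠ cst c

/-- With `a` the mean of `u`, the squared norm of `u - a` is `1 - |a|²`, and it is positive because
`u` is not constant. -/
lemma Unimodular.norm_integral_lt {u : Germ} (hu : u.Unimodular) (h : u.NonConst) :
    ‖u.integral‖ < 1 := by
  set a := u.integral with ha
  have hs : (u - cst a).SqInt := hu.sqInt.sub (sqInt_cst a)
  set x : L2 := ⟨u - cst a, hs⟩ with hx
  have i0 := hu.unimodular_star
  have i0' := hu
  have h1 : ⟪x, x⟫_ℂ = 1 - conj a * a := by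
    rw [← integral_star_mul_coe]
    simp only [hx]
    unfold Unimodular at hu
    rw [show star (u - cst a) * (u - cst a) =
      cst 1 - (cst a * star u + cst (conj a) * u - cst (conj a * a)) by
        rw [star_sub, star_cst, map_mul, map_one]; linear_combination hu]
    have i1 := i0.sqInt.cst_mul a
    have i2 := i0'.sqInt.cst_mul (conj a)
    have i3 := sqInt_cst (conj a * a)
    rw [integral_sub (sqInt_cst 1).integrable ((i1.add i2).sub i3).integrable,
      integral_sub (i1.add i2).integrable i3.integrable,
      integral_add i1.integrable i2.integrable, integral_cst, integral_cst, integral_cst_mul,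
      integral_cst_mul, integral_star, ← ha]
    ring
  rw [inner_self_eq_norm_sq_to_K, Complex.conj_mul'] at h1
  have h2 : x ≠ 0 := fun h0 => h a (sub_eq_zero.1 (congrArg Subtype.val h0))
  have h3 : 0 < ‖x‖ ^ 2 := by positivity
  have h4 : ‖x‖ ^ 2 = 1 - ‖a‖ ^ 2 := by
    apply Complex.ofReal_injective
    push_cast
    exact h1
  nlinarith [norm_nonneg a]

/-- The reproducing kernel `1 - conj (u(0)) u` at the origin of the model space of `u`. -/
def ker (u : Germ) : Germ := 1 - cst (conj u.integral) * u

/-- The backward shift `z̄ (u - u(0))` of `u`. -/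
def dker (u : Germ) : Germ := star z * (u - cst u.integral)

/-- The reproducing kernel at the origin of the model space of a nonconstant inner function is
outer. -/
lemma Hardy.of_ker_mul {u F : Germ} (hu : u.Unimodular) (hu' : Hardy u) (h : u.NonConst)
    (hF : F.SqInt) (hk : Hardy (u.ker * F)) : Hardy F := by
  refine ⟨hF, fun m => ?_⟩
  set a := conj u.integral with ha
  have hlt : ‖a‖ < 1 := by rw [ha, RCLike.norm_conj]; exact hu.norm_integral_lt h
  have hup : ∀ n : ℕ, Hardy (u ^ n) := fun n => by
    induction n with
    | zero => rw [pow_zero]; exact hardy_one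
    | succ n ih => rw [pow_succ]; exact hu'.unimodular_mul (hu.pow n) ih
  -- Iterate `F = k F + a u F`, where `k` is `u.ker`. Each `u ^ n k F` is in the Hardy space and
  -- contributes nothing, while the remainder is at most `|a| ^ n` times the `L¹` norm of `F`, with
  -- `|a| < 1`.
  have key : ∀ n : ℕ, (z ^ (m + 1) * F).integral
      = a ^ n * (z ^ (m + 1) * u ^ n * F).integral := fun n => by
    induction n with
    | zero => simp
    | succ n ih =>
      rw [ih, show z ^ (m + 1) * u ^ n * F = z ^ (m + 1) * (u ^ n * (u.ker * F))
        + cst a * (z ^ (m + 1) * u ^ (n + 1) * F) by unfold ker; rw [← ha]; ring,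
        integral_add, (hk.unimodular_mul (hu.pow n) (hup n)).2, integral_cst_mul]
      · ring
      · exact ((hk.1.unimodular_mul (hu.pow n)).unimodular_mul (unimodular_z.pow _)).integrable
      · exact ((hF.unimodular_mul ((unimodular_z.pow _).mul (hu.pow _))).cst_mul a).integrable
  have hle : ∀ n : ℕ, ‖(z ^ (m + 1) * F).integral‖ ≤ ‖a‖ ^ n * ∫ t, ‖F t‖ ∂circleMeasure :=
    fun n => by
      rw [key n, norm_mul, norm_pow]
      exact mul_le_mul_of_nonneg_left
        (norm_integral_unimodular_mul_le ((unimodular_z.pow _).mul (hu.pow _))) (by positivity)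
  have hlim := (tendsto_pow_atTop_nhds_zero_of_lt_one (norm_nonneg a) hlt).mul_const
    (∫ t, ‖F t‖ ∂circleMeasure)
  rw [zero_mul] at hlim
  exact norm_le_zero_iff.1 (ge_of_tendsto' hlim hle)

/-! ### Model spaces and their multipliers. -/

/-- The model space of `u`, as a set of germs. -/
def Model (u F : Germ) : Prop := Hardy F ∧ Hardy (u * star z * star F)

lemma hardy_ker {u : Germ} (hu : Hardy u) : Hardy u.ker := hardy_one.sub (hu.cst_mul _)

lemma hardy_dker {u : Germ} (hu : Hardy u) : Hardy u.dker := hardy_backward_shift hu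

/-- The natural conjugation `C_u` exchanges `u.ker` and `u.dker`. Both lie in the Hardy space, hence
both lie in the model space. -/
lemma conj_ker {u : Germ} (hu : u.Unimodular) : u * star z * star u.ker = u.dker := by
  unfold Unimodular at hu
  unfold ker dker
  rw [star_sub, star_one, star_mul, star_cst, Complex.conj_conj]
  linear_combination -(star z * cst u.integral) * hu

lemma conj_dker {u : Germ} (hu : u.Unimodular) : u * star z * star u.dker = u.ker := by
  have h := unimodular_z
  unfold Unimodular at hu h
  unfold ker dker
  rw [star_mul, star_star, star_sub, star_cst]
  linear_combination (u * star u - u * cst (conj u.integral)) * h + hu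

lemma model_ker {u : Germ} (hu : u.Unimodular) (hu' : Hardy u) : u.Model u.ker :=
  ⟨hardy_ker hu', by rw [conj_ker hu]; exact hardy_dker hu'⟩

lemma model_dker {u : Germ} (hu : u.Unimodular) (hu' : Hardy u) : u.Model u.dker :=
  ⟨hardy_dker hu', by rw [conj_dker hu]; exact hardy_ker hu'⟩

lemma conj_conj_eq {u : Germ} (hu : u.Unimodular) (F : Germ) :
    u * star z * star (u * star z * star F) = F := by
  have h := unimodular_z
  unfold Unimodular at hu h
  rw [star_mul, star_mul, star_star, star_star]
  linear_combination u * F * star u * h + F * hu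

lemma Model.conj {u F : Germ} (hu : u.Unimodular) (hF : u.Model F) :
    u.Model (u * star z * star F) :=
  ⟨hF.2, by rw [conj_conj_eq hu]; exact hF.1⟩

lemma Model.sub {u F G : Germ} (hF : u.Model F) (hG : u.Model G) : u.Model (F - G) :=
  ⟨hF.1.sub hG.1, by rw [star_sub, mul_sub]; exact hF.2.sub hG.2⟩

/-- The condition `u z̄ F̄ ∈ H²` says precisely that `ū F` is orthogonal to `H²`. -/
lemma Model.integral_star_mul {u F H : Germ} (hF : u.Model F) (hH : Hardy H) :
    integral (star F * (u * H)) = 0 := by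
  have h := hH.integral_star_mul (F := star u * F) (by
    rw [star_mul, star_star, mul_comm (star F), ← mul_assoc, mul_comm (star z)]; exact hF.2)
  rw [integral_star_mul_comm, star_mul, mul_assoc, h, map_zero]

lemma Model.integral_star_mul' {u F H : Germ} (hF : u.Model F) (hH : Hardy H) :
    integral (star (u * H) * F) = 0 := by
  rw [integral_star_mul_comm, hF.integral_star_mul hH, map_zero]

/-- The decomposition `H² = K_u ⊕ u H²`. -/
lemma Hardy.exists_model_add {u F : Germ} (hu : u.Unimodular) (hu' : Hardy u) (hF : Hardy F) :
    ∃ G H : Germ, F = G + u * H ∧ u.Model G ∧ Hardy H := by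
  obtain ⟨H, M, h, hH, hM, hM'⟩ := SqInt.exists_hardy_add (hF.1.unimodular_mul hu.unimodular_star)
  unfold Unimodular at hu
  have e : F - u * H = u * M := by linear_combination u * h - F * hu
  refine ⟨F - u * H, H, by ring, ⟨hF.sub (hH.unimodular_mul hu hu'), ?_⟩, hH⟩
  rw [e, star_mul]
  rwa [show u * star z * (star M * star u) = star z * star M by
    linear_combination star z * star M * hu]

/-- Boundary functions of inner functions: unimodular functions in the Hardy space. -/
structure Inner (u : Germ) : Prop where
  unimodular : u.Unimodular
  hardy : u.Hardy

lemma Inner.mul {u v : Germ} (hu : u.Inner) (hv : v.Inner) : Inner (u * v) :=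
  ⟨hu.1.mul hv.1, hv.2.unimodular_mul hu.1 hu.2⟩

lemma Inner.hardy_mul {u F : Germ} (hu : u.Inner) (hF : Hardy F) : Hardy (u * F) :=
  hF.unimodular_mul hu.1 hu.2

lemma Inner.not_nonConst {u : Germ} (hu : u.Inner) (h : Hardy (star u)) : ¬ u.NonConst :=
  fun hn => hn _ (hu.2.eq_cst h)

lemma Inner.hardy_of_ker_mul {u F : Germ} (hu : u.Inner) (h : u.NonConst)
    (hF : F.SqInt) (hk : Hardy (u.ker * F)) : Hardy F :=
  Hardy.of_ker_mul hu.1 hu.2 h hF hk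

lemma not_nonConst {u : Germ} : ¬ u.NonConst ↔ ∃ c, u = cst c := by
  simp [NonConst]

lemma Model.mul_right {A B F : Germ} (hF : A.Model F) (hB : B.Inner) : Model (A * B) F :=
  ⟨hF.1, by rw [show A * B * star z * star F = B * (A * star z * star F) by ring]
            exact hB.hardy_mul hF.2⟩

/-- This is `C_{AB} (A F) = C_B F`, the reason why `A K_B` sits inside `K_{AB}`. -/
lemma mul_conj_mul {A : Germ} (hA : A.Unimodular) (B F : Germ) :
    A * B * star z * star (A * F) = B * star z * star F := by
  unfold Unimodular at hA
  rw [star_mul]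
  linear_combination B * star z * star F * hA

lemma Model.mul_left {A B F : Germ} (hF : B.Model F) (hA : A.Inner) :
    Model (A * B) (A * F) :=
  ⟨hA.hardy_mul hF.1, by rw [mul_conj_mul hA.1]; exact hF.2⟩

/-- For constant `A`, the function `F = A (Ā F)` belongs to `A H²`, to which it is also orthogonal.
-/
lemma Model.eq_zero {A F : Germ} (hA : A.Unimodular) (h : ¬ A.NonConst) (hF : A.Model F) :
    F = 0 := by
  obtain ⟨c, rfl⟩ := not_nonConst.1 h
  have h1 : Hardy (star (cst c) * F) := by rw [star_cst]; exact hF.1.cst_mul _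
  have h2 := hF.integral_star_mul h1
  unfold Unimodular at hA
  rw [show star F * (cst c * (star (cst c) * F)) = star F * F by
    linear_combination star F * F * hA] at h2
  exact eq_zero_of_integral_star_mul_self hF.1.1 h2

/-- If multiplication by the unimodular `u` maps `K_A` into `K_T`, then `u` is inner and divides
`T / A`. -/
lemma hardy_of_mul_model {A T u : Germ} (hA : A.Inner) (hA' : A.NonConst) (hT : T.Unimodular)
    (hu : u.Unimodular) (h : ∀ F, A.Model F → T.Model (u * F)) :
    Hardy u ∧ Hardy (T * star A * star u) := by
  refine ⟨hA.hardy_of_ker_mul hA' hu.sqInt ?_, hA.hardy_of_ker_mul hA'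
    ((hT.mul hA.1.unimodular_star).mul hu.unimodular_star).sqInt ?_⟩
  · rw [mul_comm]
    exact (h _ (model_ker hA.1 hA.2)).1
  -- Since `C_A` takes `A.dker` to `A.ker`, applying `C_T` to `u * A.dker` gives `A.ker` times `T Ā
  -- ū`, and the outer factor is cancelled again.
  · have h1 := (h _ (model_dker hA.1 hA.2)).2
    have hc := conj_dker hA.1
    have hA1 := hA.1
    unfold Unimodular at hA1
    rwa [star_mul, show T * star z * (star A.dker * star u) = A.ker * (T * star A * star u) by
      linear_combination (T * star u * star A) * hc - T * star u * star z * star A.dker * hA1]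
      at h1

/-- If multiplication by the unimodular `u` maps the nonzero space `K_T` into itself, then `u` is
constant. -/
lemma eq_cst_of_mul_model {T u : Germ} (hT : T.Inner) (hT' : T.NonConst) (hu : u.Unimodular)
    (h : ∀ F, T.Model F → T.Model (u * F)) : ∃ c : ℂ, ‖c‖ = 1 ∧ u = cst c := by
  obtain ⟨h1, h2⟩ := hardy_of_mul_model hT hT' hT.1 hu h
  have hT1 := hT.1
  unfold Unimodular at hT1
  rw [mul_comm T, hT1, one_mul] at h2
  exact ⟨_, hu.norm_eq (h1.eq_cst h2), h1.eq_cst h2⟩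

/-! ### Consequences of the decomposition `K_{AB} = u K_A ⊕ v K_B`. -/

section Complement

-- `hw` says that `u` divides `B`, and `hE` that the complement of `u K_A` in `K_{AB}` lies in `v
-- K_B`. Only this half of the decomposition is assumed, so that the section also applies with `(A,
-- u)` and `(B, v)` exchanged.
variable {A B u v : Germ} (hA : A.Inner) (hu : u.Inner) (hv : v.Inner)
  (hw : Inner (B * star u))
  (hE : ∀ x, Model (A * B) x → (∀ f, A.Model f → integral (star x * (u * f)) = 0) →
    B.Model (star v * x))

-- The test vector is `u.ker`. It lies in `K_u ⊆ K_{AB}` and is orthogonal to `u H²`, so `v̄ u.ker ∈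
-- H²`; cancelling the outer kernel leaves `v̄ ∈ H²`.
include hA hu hv hw hE in
lemma hardy_star_of_complement (hu' : u.NonConst) : Hardy (star v) := by
  have hm := model_ker hu.1 hu.2
  have hu1 := hu.1
  unfold Unimodular at hu1
  have hx : Model (A * B) u.ker := by
    rw [show A * B = u * (A * (B * star u)) by linear_combination -A * B * hu1]
    exact hm.mul_right (hA.mul hw)
  have h := (hE _ hx fun f hf => hm.integral_star_mul hf.1).1
  rw [mul_comm] at h
  exact hu.hardy_of_ker_mul hu' hv.1.unimodular_star.sqInt h

-- Let `w = B ū` be nonconstant. The test vector `x = u A w.dker` is orthogonal to `u K_A`, so `v̄ x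
-- ∈ K_B`, and `C_B (v̄ x) = v Ā w.ker` is in `H²`. Multiplying by `v̄ ∈ H²` and cancelling `w.ker`
-- gives `Ā ∈ H²`, so `A` would be constant.
include hA hu hv hw hE in
lemma eq_cst_of_complement (hA' : A.NonConst) (hv' : Hardy (star v)) :
    ∃ c, B * star u = cst c := by
  by_contra hn
  have hn' : NonConst (B * star u) := by
    by_contra h
    exact hn (not_nonConst.1 h)
  set w := B * star u with hwdef
  have hu1 := hu.1
  unfold Unimodular at hu1
  have hB : B = u * w := by linear_combination -B * hu1
  have hx : Model (A * B) (u * (A * w.dker)) := by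
    rw [hB, mul_left_comm A]
    exact ((model_dker hw.1 hw.2).mul_left hA).mul_left hu
  have h := (hE _ hx fun f hf => ?_).2
  · have hA1 := hA.1
    unfold Unimodular at hA1
    have hc := conj_dker hw.1
    have hv1 := hv.1
    unfold Unimodular at hv1
    have h3 : Hardy (star v * (v * (star A * w.ker))) := by
      refine (Hardy.unimodular_mul ?_ hv.1.unimodular_star hv')
      convert h using 1
      rw [hB]
      simp only [star_mul, star_star]
      linear_combination -v * star A * hc - v * star A * w * star z * star w.dker * hu1
    rw [show star v * (v * (star A * w.ker)) = w.ker * star A by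
      linear_combination star A * w.ker * hv1] at h3
    exact hA.not_nonConst (hw.hardy_of_ker_mul hn' hA.1.unimodular_star.sqInt h3) hA'
  · rw [show star (u * (A * w.dker)) * (u * f) = star (A * w.dker) * f by
      rw [star_mul]; linear_combination star (A * w.dker) * f * hu1]
    exact hf.integral_star_mul' (hardy_dker hw.2)

end Complement

/-! ### Classification of glued conjugations. -/

/-- A conjugation `D` of the model space of `A B` which is `F ↦ ψ₁ F̄` on the model space of `A`
and `F ↦ ψ₂ F̄` on its orthogonal complement. -/
structure GluedConjugation (A B ψ₁ ψ₂ : Germ) (D : Germ → Germ) : Prop where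
  maps : ∀ F, Model (A * B) F → Model (A * B) (D F)
  involutive : ∀ F, Model (A * B) F → D (D F) = F
  inner_map : ∀ F G, Model (A * B) F → Model (A * B) G →
    integral (star (D F) * D G) = integral (star G * F)
  add : ∀ F G, Model (A * B) F → Model (A * B) G → D (F + G) = D F + D G
  left : ∀ F, Model (A * B) F → A.Model F → D F = ψ₁ * star F
  right : ∀ F, Model (A * B) F → (∀ G, A.Model G → integral (star G * F) = 0) →
    D F = ψ₂ * star F

lemma model_of_mul_model {A B F : Germ} (hA : A.Unimodular) (hF : Hardy F)
    (h : Model (A * B) (A * F)) : B.Model F :=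
  ⟨hF, by rw [← mul_conj_mul hA]; exact h.2⟩

/-- The decomposition `K_{AB} = K_A ⊕ A K_B`. -/
lemma Model.exists_add {A B F : Germ} (hA : A.Inner) (hB : B.Inner) (hF : Model (A * B) F) :
    ∃ G H : Germ, F = G + A * H ∧ A.Model G ∧ B.Model H := by
  obtain ⟨G, H, h, hG, hH⟩ := Hardy.exists_model_add hA.1 hA.2 hF.1
  refine ⟨G, H, h, hG, model_of_mul_model hA.1 hH ?_⟩
  rw [show A * H = F - G by rw [h]; ring]
  exact hF.sub (hG.mul_right hB)

namespace GluedConjugation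

variable {A B ψ₁ ψ₂ : Germ} {D : Germ → Germ}

lemma right_mul (hD : GluedConjugation A B ψ₁ ψ₂ D) (hA : A.Inner) {F : Germ} (hF : B.Model F) :
    D (A * F) = ψ₂ * star (A * F) :=
  hD.right _ (hF.mul_left hA) fun _ hG => hG.integral_star_mul hF.1

lemma apply_add (hD : GluedConjugation A B ψ₁ ψ₂ D) (hA : A.Inner) (hB : B.Inner) {F G : Germ}
    (hF : A.Model F) (hG : B.Model G) :
    D (F + A * G) = ψ₁ * star F + ψ₂ * star (A * G) := by
  rw [hD.add _ _ (hF.mul_right hB) (hG.mul_left hA), hD.left _ (hF.mul_right hB) hF,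
    hD.right_mul hA hG]

/-- With `C = C_{AB}`, a function orthogonal to `C D S` has the form `C D F` with `F`
orthogonal to `S`. -/
lemma exists_preimage (hD : GluedConjugation A B ψ₁ ψ₂ D) (hA : A.Inner) (hB : B.Inner)
    {S : Set Germ} (hS : ∀ F ∈ S, Model (A * B) F) {x : Germ} (hx : Model (A * B) x)
    (h : ∀ F ∈ S, integral (star x * (A * B * star z * star (D F))) = 0) :
    ∃ F, Model (A * B) F ∧ A * B * star z * star (D F) = x ∧
      ∀ G ∈ S, integral (star G * F) = 0 := by
  have hT := (hA.mul hB).1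
  have hy := hx.conj hT
  -- Both `C` and `D` are involutions, so the only candidate is `D C x`.
  refine ⟨D (A * B * star z * star x), hD.maps _ hy, ?_, fun G hG => ?_⟩
  · rw [hD.involutive _ hy, conj_conj_eq hT]
  · rw [integral_star_mul_comm, ← hD.inner_map _ _ (hS G hG) (hD.maps _ hy), hD.involutive _ hy,
      show star (D G) * (A * B * star z * star x) = star x * (A * B * star z * star (D G)) by ring,
      h G hG, map_zero]

/-- Let `u = C_{AB} ψ₁` and `v = C_{AB} ψ₂ A`. The orthogonal complement of `u K_A` in `K_{AB}` is
contained in `v K_B`. -/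
theorem left_complement (hD : GluedConjugation A B ψ₁ ψ₂ D) (hA : A.Inner) (hB : B.Inner)
    {u v : Germ} (hu : u = A * B * star z * star ψ₁) (hv : v = A * B * star z * star ψ₂ * A)
    (hv' : v.Unimodular) {x : Germ} (hx : Model (A * B) x)
    (h : ∀ f, A.Model f → integral (star x * (u * f)) = 0) : B.Model (star v * x) := by
  obtain ⟨F, hF, hFx, hF'⟩ := hD.exists_preimage hA hB (S := {f | A.Model f})
    (fun f hf => Model.mul_right hf hB) hx fun f hf => by
      rw [hD.left f (Model.mul_right hf hB) hf, ← h f hf, hu, star_mul, star_star]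
      ring_nf
  obtain ⟨G, H, e, hG, hH⟩ := hF.exists_add hA hB
  -- `F` is orthogonal to `K_A`, so its `K_A` component `G` satisfies `⟪G, G⟫ = ⟪G, F⟫ = 0`.
  have h0 : G = 0 := by
    have h1 := hF' G hG
    rw [e, mul_add, integral_add (hG.1.1.sqInt_star.integrable_mul hG.1.1)
      (hG.1.1.sqInt_star.integrable_mul (hA.hardy_mul hH.1).1), hG.integral_star_mul hH.1,
      add_zero] at h1
    exact eq_zero_of_integral_star_mul_self hG.1.1 h1
  rw [h0, zero_add] at e
  have h2 : star v * x = H := by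
    unfold Unimodular at hv'
    rw [← hFx, e, hD.right_mul hA hH, star_mul, star_star]
    linear_combination -star v * H * hv + H * hv'
  rwa [h2]

/-- Let `u = C_{AB} ψ₁` and `v = C_{AB} ψ₂ A`. The orthogonal complement of `v K_B` in `K_{AB}` is
contained in `u K_A`. -/
theorem right_complement (hD : GluedConjugation A B ψ₁ ψ₂ D) (hA : A.Inner) (hB : B.Inner)
    {u v : Germ} (hu : u = A * B * star z * star ψ₁) (hv : v = A * B * star z * star ψ₂ * A)
    (hu' : u.Unimodular) {x : Germ} (hx : Model (A * B) x)
    (h : ∀ f, B.Model f → integral (star x * (v * f)) = 0) : A.Model (star u * x) := by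
  obtain ⟨F, hF, hFx, hF'⟩ := hD.exists_preimage hA hB (S := {g | ∃ f, B.Model f ∧ g = A * f})
    (by rintro _ ⟨f, hf, rfl⟩; exact hf.mul_left hA) hx (by
      rintro _ ⟨f, hf, rfl⟩
      rw [hD.right_mul hA hf, ← h f hf, hv, star_mul, star_star]
      ring_nf)
  obtain ⟨G, H, e, hG, hH⟩ := hF.exists_add hA hB
  have hAH := (hA.hardy_mul hH.1).1
  have h0 : A * H = 0 := by
    have h1 := hF' (A * H) ⟨H, hH, rfl⟩
    rw [e, mul_add, integral_add (hAH.sqInt_star.integrable_mul hG.1.1)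
      (hAH.sqInt_star.integrable_mul hAH), hG.integral_star_mul' hH.1, zero_add] at h1
    exact eq_zero_of_integral_star_mul_self hAH h1
  rw [h0, add_zero] at e
  have h2 : star u * x = G := by
    unfold Unimodular at hu'
    rw [← hFx, e, hD.left _ (hG.mul_right hB) hG, star_mul, star_star]
    linear_combination -star u * G * hu + G * hu'
  rwa [h2]

/-- A glued conjugation given by a single multiplier is a multiple of the natural one. -/
lemma eq_of_forall (hD : GluedConjugation A B ψ₁ ψ₂ D) (hA : A.Inner) (hB : B.Inner)
    {ψ : Germ} (hψ : ψ.Unimodular) (h : ∀ F, Model (A * B) F → D F = ψ * star F) :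
    ∃ c : ℂ, ‖c‖ = 1 ∧ ∀ F, Model (A * B) F → D F = cst c * (A * B * star z * star F) := by
  have hT := hA.mul hB
  by_cases hn : NonConst (A * B)
  · have hw : Unimodular (A * B * star z * star ψ) :=
      (hT.1.mul unimodular_z.unimodular_star).mul hψ.unimodular_star
    obtain ⟨c, hc, e⟩ := eq_cst_of_mul_model hT hn hw fun F hF => by
      have h1 := (hD.maps F hF).conj hT.1
      rw [h F hF, star_mul, star_star] at h1
      rwa [show A * B * star z * star ψ * F = A * B * star z * (F * star ψ) by ring]
    -- From `A B z̄ ψ̄ = c` one gets `ψ = c̄ A B z̄`, whence the conjugate.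
    refine ⟨conj c, by rw [RCLike.norm_conj, hc], fun F hF => ?_⟩
    have e' := congrArg star e
    rw [star_cst] at e'
    have e2 := conj_conj_eq hT.1 (ψ * star F)
    rw [h F hF, ← e', ← e2]
    simp only [star_mul, star_star]
    ring
  · refine ⟨1, by simp, fun F hF => ?_⟩
    rw [h F hF, hF.eq_zero hT.1 hn]
    simp

/-- Glued conjugations are multiples of `C_{AB}` or direct sums of multiples of `C_A` and
`A C_B Ā`. The inner functions `A` and `B` may be constant. -/
theorem classification (hD : GluedConjugation A B ψ₁ ψ₂ D) (hA : A.Inner) (hB : B.Inner)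
    (hψ₁ : ψ₁.Unimodular) (hψ₂ : ψ₂.Unimodular) :
    (∃ c : ℂ, ‖c‖ = 1 ∧ ∀ F, Model (A * B) F → D F = cst c * (A * B * star z * star F)) ∨
    (∃ c₁ c₂ : ℂ, ‖c₁‖ = 1 ∧ ‖c₂‖ = 1 ∧ ∀ F G, A.Model F → B.Model G →
      D (F + A * G) = cst c₁ * (A * star z * star F) + A * (cst c₂ * (B * star z * star G))) := by
  by_cases hA' : A.NonConst
  swap
  -- For constant `A` the space `K_A` is zero, so `ψ₂` serves on all of `K_{AB}`; for constant `B`,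
  -- treated next, `ψ₁` does.
  · refine .inl (hD.eq_of_forall hA hB hψ₂ fun F hF => hD.right F hF fun G hG => ?_)
    rw [hG.eq_zero hA.1 hA', star_zero, zero_mul, ← map_zero cst, integral_cst]
  by_cases hB' : B.NonConst
  swap
  · refine .inl (hD.eq_of_forall hA hB hψ₁ fun F hF => ?_)
    obtain ⟨G, H, e, hG, hH⟩ := hF.exists_add hA hB
    rw [hH.eq_zero hB.1 hB', mul_zero, add_zero] at e
    exact hD.left F hF (e ▸ hG)
  have hT := hA.mul hB
  obtain ⟨u, hu⟩ : ∃ u, u = A * B * star z * star ψ₁ := ⟨_, rfl⟩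
  obtain ⟨v, hv⟩ : ∃ v, v = A * B * star z * star ψ₂ * A := ⟨_, rfl⟩
  have hu1 : u.Unimodular := by
    rw [hu]; exact (hT.1.mul unimodular_z.unimodular_star).mul hψ₁.unimodular_star
  have hv1 : v.Unimodular := by
    rw [hv]
    exact ((hT.1.mul unimodular_z.unimodular_star).mul hψ₂.unimodular_star).mul hA.1
  have hA1 := hA.1
  have hB1 := hB.1
  have hu2 := hu1
  unfold Unimodular at hA1 hB1 hu2
  have hψ₁u : ψ₁ = A * B * star z * star u := by
    rw [hu]
    have := conj_conj_eq hT.1 ψ₁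
    exact this.symm
  have hψ₂v : ψ₂ = A * B * star z * star v * A := by
    have := conj_conj_eq hT.1 ψ₂
    rw [hv, star_mul]
    linear_combination -this - (A * B * star z * star (A * B * star z * star ψ₂)) * hA1
  obtain ⟨hu3, hw1⟩ := hardy_of_mul_model hA hA' hT.1 hu1 fun F hF => by
    have h1 := (hD.maps F (hF.mul_right hB)).conj hT.1
    rw [hD.left _ (hF.mul_right hB) hF, star_mul, star_star] at h1
    rwa [hu, show A * B * star z * star ψ₁ * F = A * B * star z * (F * star ψ₁) by ring]
  obtain ⟨hv3, hw2⟩ := hardy_of_mul_model hB hB' hT.1 hv1 fun F hF => by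
    have h1 := (hD.maps _ (hF.mul_left hA)).conj hT.1
    rw [hD.right_mul hA hF, star_mul, star_star] at h1
    rwa [hv, show A * B * star z * star ψ₂ * A * F = A * B * star z * (A * F * star ψ₂) by ring]
  rw [show A * B * star A = B by linear_combination B * hA1] at hw1
  rw [show A * B * star B = A by linear_combination A * hB1] at hw2
  have iu : u.Inner := ⟨hu1, hu3⟩
  have iv : v.Inner := ⟨hv1, hv3⟩
  have iw1 : Inner (B * star u) := ⟨hB.1.mul hu1.unimodular_star, hw1⟩
  have iw2 : Inner (A * star v) := ⟨hA.1.mul hv1.unimodular_star, hw2⟩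
  have E1 := fun x hx => hD.left_complement hA hB hu hv hv1 (x := x) hx
  have E2 := fun x hx => hD.right_complement hA hB hu hv hu1 (x := x) hx
  rw [mul_comm A B] at E2
  -- If `v` is not constant, the complement lemmas with the roles exchanged make `u` and `A v̄`
  -- constant.
  by_cases hvc : v.NonConst
  · have hus := hardy_star_of_complement hB iv iu iw2 E2 hvc
    obtain ⟨b, hb⟩ := eq_cst_of_complement hB iv iu iw2 E2 hB' hus
    obtain ⟨a, ha⟩ : ∃ a, star u = cst a := ⟨_, hus.eq_cst (by rwa [star_star])⟩
    rw [ha] at hψ₁u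
    have hψ₂b : ψ₂ = A * B * star z * cst b := by
      rw [hψ₂v, ← hb]; ring
    -- Take `f = A.ker` and `D f = G + A H`. Comparing `D (D f) = f` with `a C_{AB} (D f) = f` gives
    -- `A H = 0` if `a ≠ b`. Then `D f ∈ K_A`, so `f B̄ = a C_A (D f)` is in `H²`; cancelling the
    -- outer `f` makes `B` constant.
    have hab : a = b := by
      by_contra hab
      have hf := model_ker hA.1 hA.2
      have hDf := hD.maps _ (hf.mul_right hB)
      obtain ⟨G, H, e, hG, hH⟩ := hDf.exists_add hA hB
      have h1 := hD.involutive _ (hf.mul_right hB)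
      have h2 := hD.left _ (hf.mul_right hB) hf
      have hu4 : u = cst (conj a) := by rw [← star_star u, ha, star_cst]
      have h3 : A * B * star z * (cst a * star (D A.ker)) = A.ker := by
        rw [h2, hψ₁u, show A * B * star z * cst a * star A.ker
          = cst a * (A * B * star z * star A.ker) by ring, star_mul, star_cst]
        rw [ha, hu4] at hu2
        linear_combination (cst a * cst (conj a)) * conj_conj_eq hT.1 A.ker + A.ker * hu2
      have h4 : cst (b - a) * (A * B * star z * star (A * H)) = 0 := by
        rw [e, hD.apply_add hA hB hG hH, hψ₁u, hψ₂b] at h1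
        rw [e, star_add] at h3
        rw [map_sub]
        linear_combination h1 - h3
      have h5 : A * B * star z * star (A * H) = 0 := by
        have h6 := congrArg (fun F => cst (b - a)⁻¹ * F) h4
        simp only [mul_zero, ← mul_assoc, ← map_mul] at h6
        rwa [inv_mul_cancel₀ (sub_ne_zero.2 (Ne.symm hab)), map_one, one_mul, mul_assoc, mul_assoc,
          ← mul_assoc B, ← mul_assoc A, ← mul_assoc A] at h6
      have h7 : A * H = 0 := by
        rw [← conj_conj_eq hT.1 (A * H), h5, star_zero, mul_zero]
      rw [h7, add_zero] at e
      have h8 := (e ▸ hG : A.Model (D A.ker)).2.cst_mul a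
      rw [show cst a * (A * star z * star (D A.ker)) = A.ker * star B by
        linear_combination star B * h3 - cst a * A * star z * star (D A.ker) * hB1] at h8
      exact hB.not_nonConst (hA.hardy_of_ker_mul hA' hB.1.unimodular_star.sqInt h8) hB'
    refine .inl ⟨a, hu1.unimodular_star.norm_eq ha, fun F hF => ?_⟩
    obtain ⟨G, H, e, hG, hH⟩ := hF.exists_add hA hB
    rw [e, hD.apply_add hA hB hG hH, star_add, hψ₁u, hψ₂b, hab]
    ring
  -- Here `v = d` and `B ū = c`, so `ψ₁ = c A z̄` and `ψ₂ Ā = d̄ A B z̄`: the two summands decouple.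
  · obtain ⟨d, hd⟩ := not_nonConst.1 hvc
    have hvs : star v = cst (conj d) := by rw [hd, star_cst]
    obtain ⟨c, hc⟩ := eq_cst_of_complement hA iu iv iw1 E1 hA' (by rw [hvs]; exact hardy_cst _)
    refine .inr ⟨c, conj d, iw1.1.norm_eq hc, hv1.unimodular_star.norm_eq hvs,
      fun F G hF hG => ?_⟩
    rw [hD.apply_add hA hB hF hG, hψ₁u, hψ₂v, ← hc, ← hvs, star_mul]
    linear_combination (A * B * star z * star v * star G) * hA1

end GluedConjugation

end Germ

open ModelSpace.Germ

/-! ### The form of `M_z`-conjugations. -/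

lemma coe_mulOp (φ : LInf) (f : L2) : ((mulOp φ f : L2) : Germ) = (φ : Germ) * (f : Germ) := by
  ext1
  exact (Lp.coeFn_lpSMul φ f).trans (AEEqFun.coeFn_mul (φ : Germ) (f : Germ)).symm

/-- Integration against `F` is a bounded functional on continuous functions, and trigonometric
polynomials are dense there. -/
lemma integral_continuousMap_mul_eq_zero {F : UnitAddCircle → ℂ} (hF : Integrable F circleMeasure)
    (h : ∀ n : ℤ, ∫ t, fourier n t * F t ∂circleMeasure = 0) (g : C(UnitAddCircle, ℂ)) :
    ∫ t, g t * F t ∂circleMeasure = 0 := by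
  have hint : ∀ g : C(UnitAddCircle, ℂ), Integrable (fun t => g t * F t) circleMeasure := fun g =>
    hF.bdd_mul g.continuous.aestronglyMeasurable (c := ‖g‖) (ae_of_all _ g.norm_coe_le_norm)
  let L : C(UnitAddCircle, ℂ) →L[ℂ] ℂ := LinearMap.mkContinuous
    { toFun := fun g => ∫ t, g t * F t ∂circleMeasure
      map_add' := fun g g' => by
        rw [← MeasureTheory.integral_add (hint g) (hint g')]
        simp only [ContinuousMap.add_apply, add_mul]
      map_smul' := fun c g => by
        rw [RingHom.id_apply, smul_eq_mul, ← MeasureTheory.integral_const_mul]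
        simp only [ContinuousMap.smul_apply, smul_eq_mul, mul_assoc] }
    (∫ t, ‖F t‖ ∂circleMeasure) fun g => by
      refine (norm_integral_le_integral_norm _).trans ?_
      rw [mul_comm, ← MeasureTheory.integral_const_mul]
      refine integral_mono (hint g).norm (hF.norm.const_mul _) fun t => ?_
      simp only [norm_mul]
      exact mul_le_mul_of_nonneg_right (g.norm_coe_le_norm t) (norm_nonneg _)
  have hle : (Submodule.span ℂ (Set.range (fourier (T := 1)))).topologicalClosure
      ≤ LinearMap.ker (L : C(UnitAddCircle, ℂ) →ₗ[ℂ] ℂ) := by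
    refine Submodule.topologicalClosure_minimal _ (Submodule.span_le.2 ?_) L.isClosed_ker
    rintro _ ⟨n, rfl⟩
    exact h n
  rw [span_fourier_closure_eq_top] at hle
  exact hle (Submodule.mem_top (x := g))

/-- The measures `|ψ|² dm` and `dm` have the same Fourier coefficients, hence agree on continuous
functions, hence coincide; so their densities agree almost everywhere. -/
lemma norm_ae_eq_one_of_fourier {ψ : UnitAddCircle → ℂ} (hψ : MemLp ψ 2 circleMeasure)
    (h : ∀ n : ℤ, ∫ t, fourier n t * ((‖ψ t‖ ^ 2 : ℝ) : ℂ) ∂circleMeasure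
      = ∫ t, fourier n t ∂circleMeasure) :
    ∀ᵐ t ∂circleMeasure, ‖ψ t‖ = 1 := by
  have hsq : Integrable (fun t => ‖ψ t‖ ^ 2) circleMeasure := hψ.integrable_norm_pow two_ne_zero
  have hint : Integrable (fun t => ((‖ψ t‖ ^ 2 : ℝ) : ℂ)) circleMeasure := hsq.ofReal
  have hcont : ∀ g : C(UnitAddCircle, ℂ), Integrable (fun t => g t) circleMeasure := fun g =>
    g.continuous.integrable_of_hasCompactSupport (HasCompactSupport.of_compactSpace _)
  have hmul : ∀ g : C(UnitAddCircle, ℂ),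
      Integrable (fun t => g t * ((‖ψ t‖ ^ 2 : ℝ) : ℂ)) circleMeasure := fun g =>
    hint.bdd_mul g.continuous.aestronglyMeasurable (c := ‖g‖) (ae_of_all _ g.norm_coe_le_norm)
  have key : ∀ g : C(UnitAddCircle, ℂ), ∫ t, g t * ((‖ψ t‖ ^ 2 : ℝ) : ℂ) ∂circleMeasure
      = ∫ t, g t ∂circleMeasure := fun g => by
    have h1 := integral_continuousMap_mul_eq_zero (hint.sub (integrable_const 1))
      (fun n => by
        simp only [Pi.sub_apply, mul_sub, mul_one]
        rw [MeasureTheory.integral_sub (hmul _) (hcont _), h n, sub_self]) g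
    simp only [Pi.sub_apply, mul_sub, mul_one] at h1
    rw [MeasureTheory.integral_sub (hmul _) (hcont _)] at h1
    exact sub_eq_zero.1 h1
  have hm : AEMeasurable (fun t => ENNReal.ofReal (‖ψ t‖ ^ 2)) circleMeasure :=
    hsq.1.aemeasurable.ennreal_ofReal
  have hfin : IsFiniteMeasure (circleMeasure.withDensity fun t => ENNReal.ofReal (‖ψ t‖ ^ 2)) :=
    isFiniteMeasure_withDensity_ofReal hsq.2
  have heq : circleMeasure.withDensity (fun t => ENNReal.ofReal (‖ψ t‖ ^ 2)) = circleMeasure := by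
    refine ext_of_forall_integral_eq_of_IsFiniteMeasure fun f => ?_
    rw [integral_withDensity_eq_integral_toReal_smul₀ hm
      (ae_of_all _ fun t => ENNReal.ofReal_lt_top)]
    have h2 := key ⟨fun t => (f t : ℂ), by fun_prop⟩
    simp only [ContinuousMap.coe_mk] at h2
    apply Complex.ofReal_injective
    rw [← integral_complex_ofReal, ← integral_complex_ofReal, ← h2]
    congr 1 with t
    rw [ENNReal.toReal_ofReal (by positivity), smul_eq_mul, Complex.ofReal_mul, mul_comm]
  have h1 := (withDensity_eq_iff_of_sigmaFinite hm aemeasurable_one).1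
    (heq.trans withDensity_one.symm)
  filter_upwards [h1] with t ht
  rw [ENNReal.ofReal_eq_one] at ht
  exact (pow_eq_one_iff_of_nonneg (norm_nonneg _) two_ne_zero).1 ht

/-- The `M_z`-conjugations are the maps `f ↦ ψ f̄` with `ψ` unimodular. -/
theorem IsMzConjugation.exists_unimodular {C : L2 →ₗ⋆[ℂ] L2} (hC : IsMzConjugation C) :
    ∃ ψ : Germ, ψ.Unimodular ∧ ∀ f : L2, ((C f : L2) : Germ) = ψ * star (f : Germ) := by
  set ψ : Germ := ((C (fourierLp 2 0) : L2) : Germ) with hψ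
  have hz := unimodular_z
  unfold Unimodular at hz
  have hmul : ∀ f : L2, z * ((C f : L2) : Germ) = ((C (mulOp (star zFun) f) : L2) : Germ) :=
    fun f => by
      rw [← hC.mul_comm, coe_mulOp]
      rfl
  have hpos : ∀ n : ℕ, ((C (fourierLp 2 (n : ℤ)) : L2) : Germ) = ψ * star (z ^ n) := fun n => by
    induction n with
    | zero => simp [hψ]
    | succ n ih =>
      have h := hmul (fourierLp 2 ((n + 1 : ℕ) : ℤ))
      rw [show mulOp (star zFun) (fourierLp 2 ((n + 1 : ℕ) : ℤ)) = fourierLp 2 (n : ℤ) by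
        apply Subtype.ext
        rw [coe_mulOp, coe_fourierLp, coe_fourierLp]
        change star z * z ^ (n + 1) = z ^ n
        linear_combination z ^ n * hz, ih] at h
      rw [pow_succ, star_mul]
      linear_combination star z * h - ((C (fourierLp 2 ((n + 1 : ℕ) : ℤ)) : L2) : Germ) * hz
  have hneg : ∀ n : ℕ, ((C (fourierLp 2 (-n : ℤ)) : L2) : Germ) = ψ * z ^ n := fun n => by
    induction n with
    | zero => simp [hψ]
    | succ n ih =>
      have h := hmul (fourierLp 2 (-n : ℤ))
      rw [show mulOp (star zFun) (fourierLp 2 (-n : ℤ)) = fourierLp 2 (-((n + 1 : ℕ) : ℤ)) by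
        apply Subtype.ext
        rw [coe_mulOp, coe_fourierLp_neg, coe_fourierLp_neg]
        change star z * star (z ^ n) = star (z ^ (n + 1))
        rw [pow_succ, star_mul], ih] at h
      rw [← h]
      ring
  have hsymm : ∀ f g, ⟪C f, g⟫_ℂ = ⟪C g, f⟫_ℂ := fun f g => by
    conv_lhs => rw [← hC.involutive g]
    exact hC.inner_map f (C g)
  have hall : ∀ n : ℤ, ((C (fourierLp 2 n) : L2) : Germ)
      = ψ * star ((fourierLp 2 n : L2) : Germ) := fun n => by
    rcases le_or_gt n 0 with hn | hn
    · obtain ⟨m, rfl⟩ : ∃ m : ℕ, n = -(m : ℤ) := ⟨(-n).toNat, by omega⟩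
      rw [hneg, coe_fourierLp_neg, star_star]
    · obtain ⟨m, rfl⟩ : ∃ m : ℕ, n = m := ⟨n.toNat, by omega⟩
      rw [hpos, coe_fourierLp]
  have hψs : ψ.SqInt := (C (fourierLp 2 0)).2
  have hψu : ψ.Unimodular := by
    rw [unimodular_iff]
    refine norm_ae_eq_one_of_fourier hψs.memLp fun n => ?_
    have h1 := hC.inner_map (fourierLp 2 n) (fourierLp 2 0)
    rw [← integral_star_mul_coe, ← integral_star_mul_coe, hall, ← hψ, star_mul, star_star] at h1
    refine (integral_congr_ae ?_).trans (h1.trans (integral_congr_ae ?_))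
    · filter_upwards [AEEqFun.coeFn_mul (((fourierLp 2 n : L2) : Germ) * star ψ) ψ,
        AEEqFun.coeFn_mul ((fourierLp 2 n : L2) : Germ) (star ψ), AEEqFun.coeFn_star ψ,
        coeFn_fourierLp (T := 1) 2 n] with t h1 h2 h3 h4
      rw [h1, Pi.mul_apply, h2, Pi.mul_apply, h3, Pi.star_apply, h4, mul_assoc]
      congr 1
      rw [Complex.star_def, Complex.conj_mul']
      push_cast
      rfl
    · filter_upwards [AEEqFun.coeFn_mul (star ((fourierLp 2 0 : L2) : Germ)) (fourierLp 2 n : L2),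
        AEEqFun.coeFn_star ((fourierLp 2 0 : L2) : Germ), coeFn_fourierLp (T := 1) 2 0,
        coeFn_fourierLp (T := 1) 2 n] with t h1 h2 h3 h4
      rw [h1, Pi.mul_apply, h2, Pi.star_apply, h3, h4, fourier_zero, star_one, one_mul]
  refine ⟨ψ, hψu, fun f => ?_⟩
  rw [← sub_eq_zero]
  have hs : (ψ * star (f : Germ)).SqInt := (sqInt_coe f).sqInt_star.unimodular_mul hψu
  -- The pairing of `g` with `C f` is symmetric in `f` and `g`, and so is that of `g` with `ψ f̄`.
  -- Exchanging `f` with an exponential `g` moves the difference onto `g`, where it is known to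
  -- vanish; no continuity of `C` is needed.
  have hdiff : ∀ g : L2, integral (star (g : Germ) * ((C f : Germ) - ψ * star (f : Germ)))
      = integral (star (f : Germ) * ((C g : Germ) - ψ * star (g : Germ))) := fun g => by
    have h1 := congrArg conj (hsymm f g)
    rw [← integral_star_mul_coe, ← integral_star_mul_coe, ← integral_star_mul_comm,
      ← integral_star_mul_comm] at h1
    have hs' : (ψ * star (g : Germ)).SqInt := (sqInt_coe g).sqInt_star.unimodular_mul hψu
    rw [mul_sub, mul_sub,
      Germ.integral_sub ((sqInt_coe g).sqInt_star.integrable_mul (sqInt_coe _))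
        ((sqInt_coe g).sqInt_star.integrable_mul hs),
      Germ.integral_sub ((sqInt_coe f).sqInt_star.integrable_mul (sqInt_coe _))
        ((sqInt_coe f).sqInt_star.integrable_mul hs'), h1]
    ring_nf
  refine eq_zero_of_integral_eq_zero ((sqInt_coe (C f)).sub hs) (fun n => ?_) fun n => ?_
  · have h := hdiff (fourierLp 2 (-n : ℤ))
    rwa [hneg, coe_fourierLp_neg, star_star, sub_self, mul_zero, ← map_zero cst, integral_cst] at h
  · have h := hdiff (fourierLp 2 (n : ℤ))
    rwa [hpos, coe_fourierLp, sub_self, mul_zero, ← map_zero cst, integral_cst] at h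

/-! ### Boundary values of inner functions. -/

namespace InnerFunction

lemma coeFn_bdry (θ : InnerFunction) : ⇑(θ.bdry : Germ) =ᵐ[circleMeasure] θ.boundaryFun :=
  MemLp.coeFn_toLp _

lemma bdry_eq_mul {θ α β : InnerFunction} (h : θ.IsQuotient α β) :
    (θ.bdry : Germ) = (α.bdry : Germ) * (β.bdry : Germ) := by
  ext1
  filter_upwards [AEEqFun.coeFn_mul (α.bdry : Germ) (β.bdry : Germ), θ.coeFn_bdry, α.coeFn_bdry,
    β.coeFn_bdry, θ.ae_tendsto, α.ae_tendsto, β.ae_tendsto] with t h1 h2 h3 h4 h5 h6 h7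
  rw [h1, Pi.mul_apply, h2, h3, h4]
  refine tendsto_nhds_unique h5.2 ((h6.2.mul h7.2).congr' ?_)
  filter_upwards [Ioo_mem_nhdsLT (zero_lt_one' ℝ)] with r hr
  refine (h _ ?_).symm
  rw [mem_ball_zero_iff, norm_mul, Circle.norm_coe, mul_one, Complex.norm_real, Real.norm_eq_abs,
    abs_of_pos hr.1]
  exact hr.2

/-- The mean value property on circles centred at the origin. -/
lemma integral_comp_toCircle {f : ℂ → ℂ} (hf : DifferentiableOn ℂ f (Metric.ball 0 1)) {r : ℝ}
    (hr : r ∈ Set.Ioo (0 : ℝ) 1) : ∫ t, f (r * toCircle t) ∂circleMeasure = f 0 := by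
  have hd : DiffContOnCl ℂ f (Metric.ball 0 |r|) := by
    rw [abs_of_pos hr.1]
    exact hf.diffContOnCl_ball (Metric.closedBall_subset_ball hr.2)
  rw [← hd.circleAverage, integral_haarAddCircle,
    ← AddCircle.intervalIntegral_preimage 1 0 (fun t => f (r * toCircle t)), Real.circleAverage_def]
  have h := intervalIntegral.integral_comp_mul_left (a := 0) (b := 1)
    (fun φ => f (circleMap 0 r φ)) (c := 2 * Real.pi) (by positivity)
  simp only [mul_zero, mul_one] at h
  rw [← h]
  simp [circleMap, toCircle_apply_mk, Circle.coe_exp]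

/-- The mean value property, applied to `w ^ (n + 1) θ(w)`, which vanishes at the origin, gives zero
on every circle of radius `r < 1`. Boundedness of `θ` permits dominated convergence as `r → 1`. -/
lemma inner_bdry (θ : InnerFunction) : Inner (θ.bdry : Germ) := by
  have hu : Unimodular (θ.bdry : Germ) := by
    rw [unimodular_iff]
    filter_upwards [θ.coeFn_bdry, θ.ae_tendsto] with t h1 h2
    rw [h1, h2.1]
  refine ⟨hu, hu.sqInt, fun n => ?_⟩
  obtain ⟨u, -, hu, hu1⟩ := exists_seq_strictMono_tendsto' (show (0 : ℝ) < 1 by norm_num)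
  have hlim : Tendsto u atTop (𝓝[<] 1) :=
    tendsto_nhdsWithin_iff.2 ⟨hu1, Eventually.of_forall fun n => (hu n).2⟩
  obtain ⟨M, hM⟩ := θ.bounded
  have hmem : ∀ k (t : UnitAddCircle), (u k * toCircle t : ℂ) ∈ Metric.ball (0 : ℂ) 1 :=
    fun k t => by
      rw [mem_ball_zero_iff, norm_mul, Circle.norm_coe, mul_one, Complex.norm_real,
        Real.norm_eq_abs, abs_of_pos (hu k).1]
      exact (hu k).2
  have hd : DifferentiableOn ℂ (fun w => w ^ (n + 1) * θ.toFun w) (Metric.ball 0 1) :=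
    (differentiableOn_id.pow _).mul θ.differentiableOn
  have h0 : ∀ k, ∫ t, (u k * toCircle t : ℂ) ^ (n + 1) * θ.toFun (u k * toCircle t) ∂circleMeasure
      = 0 := fun k => by
    rw [integral_comp_toCircle hd (hu k)]
    simp
  refine tendsto_nhds_unique (tendsto_integral_of_dominated_convergence (fun _ => M)
    (fun k => ?_) (integrable_const M) (fun k => ae_of_all _ fun t => ?_) ?_)
    (tendsto_const_nhds.congr fun k => (h0 k).symm)
  · exact (hd.continuousOn.comp_continuous (by fun_prop) (hmem k)).aestronglyMeasurable
  · rw [norm_mul, norm_pow]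
    have h1 := mem_ball_zero_iff.1 (hmem k t)
    exact (mul_le_of_le_one_left (norm_nonneg _) (pow_le_one₀ (norm_nonneg _) h1.le)).trans
      (hM _ (hmem k t))
  · filter_upwards [θ.coeFn_bdry, θ.ae_tendsto, coeFn_z_pow (n + 1),
      AEEqFun.coeFn_mul (z ^ (n + 1)) (θ.bdry : Germ)] with t h1 h2 h3 h4
    rw [h4, Pi.mul_apply, h1, h3]
    refine Tendsto.mul ?_ (h2.2.comp hlim)
    have h5 : ((fourier ((n + 1 : ℕ) : ℤ) t : ℂ)) = (1 * toCircle t : ℂ) ^ (n + 1) := by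
      rw [fourier_apply, toCircle_zsmul, zpow_natCast, Circle.coe_pow, one_mul]
    rw [h5]
    exact (((Complex.continuous_ofReal.tendsto 1).comp hu1).mul_const _).pow _

end InnerFunction

/-! ### Translation between subspaces of `L²` and germs. -/

lemma coe_mulOp_star (φ : LInf) (f : L2) :
    ((mulOp (star φ) f : L2) : Germ) = star (φ : Germ) * (f : Germ) := coe_mulOp _ _

lemma coe_modelConj (θ : InnerFunction) (f : L2) :
    ((modelConj θ f : L2) : Germ) = (θ.bdry : Germ) * star z * star (f : Germ) := by
  rw [modelConj, coe_mulOp, coe_mulOp_star, mul_assoc]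
  rfl

lemma coe_smul (c : ℂ) (f : L2) : ((c • f : L2) : Germ) = cst c * (f : Germ) :=
  smul_eq_cst_mul c (f : Germ)

/-- Orthogonality of `f` to `θ H²` is orthogonality of `θ̄ f` to `H²`, that is, `θ z̄ f̄ ∈ H²`. -/
lemma mem_modelSpace_iff {θ : InnerFunction} {f : L2} :
    f ∈ modelSpace θ ↔ Model (θ.bdry : Germ) (f : Germ) := by
  constructor
  · rintro ⟨h1, h2⟩
    refine ⟨(hardy_coe_iff f).2 h1, ?_⟩
    have h3 := hardy_star_z_mul_star (F := star (θ.bdry : Germ) * (f : Germ))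
      ((sqInt_coe f).unimodular_mul θ.inner_bdry.1.unimodular_star) fun n => by
        rw [← mul_assoc, ← star_mul, ← coe_fourierLp, ← coe_mulOp, integral_star_mul_coe]
        refine h2 _ ⟨fourierLp 2 (n : ℤ), (hardy_coe_iff _).1 ?_, rfl⟩
        rw [coe_fourierLp]
        exact ⟨(unimodular_z.pow _).sqInt, fun m => by
          rw [← pow_add, add_right_comm]; exact integral_z_pow_succ _⟩
    rwa [star_mul, star_star, show star z * (star (f : Germ) * (θ.bdry : Germ))
      = (θ.bdry : Germ) * star z * star (f : Germ) by ring] at h3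
  · rintro h
    refine ⟨(hardy_coe_iff f).1 h.1, ?_⟩
    rintro _ ⟨g, hg, rfl⟩
    rw [← integral_star_mul_coe, coe_mulOp]
    exact h.integral_star_mul' ((hardy_coe_iff g).2 hg)

lemma mem_orthogonal_modelSpace_iff {θ : InnerFunction} {f : L2} :
    f ∈ (modelSpace θ)ᗮ ↔
      ∀ F, Model (θ.bdry : Germ) F → integral (star F * (f : Germ)) = 0 := by
  refine ⟨fun h F hF => ?_, fun h g hg => ?_⟩
  · have h1 := h ⟨F, hF.1.1⟩ (mem_modelSpace_iff.2 hF)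
    rwa [← integral_star_mul_coe] at h1
  · rw [← integral_star_mul_coe]
    exact h _ (mem_modelSpace_iff.1 hg)

lemma coe_proj {θ : InnerFunction} {f : L2} {G M : Germ} (e : (f : Germ) = G + M)
    (hG : Model (θ.bdry : Germ) G)
    (hM : ∀ F, Model (θ.bdry : Germ) F → integral (star F * M) = 0) :
    ((proj θ f : L2) : Germ) = G := by
  have h := Submodule.eq_starProjection_of_mem_orthogonal (K := modelSpace θ) (u := f)
    (v := ⟨G, hG.1.1⟩) (mem_modelSpace_iff.2 hG) (mem_orthogonal_modelSpace_iff.2 fun F hF => by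
      rw [AddSubgroupClass.coe_sub, e, add_sub_cancel_left]
      exact hM F hF)
  rw [proj, h]

lemma coe_directSumMap {α β : InnerFunction} (c₁ c₂ : ℂ) {f : L2} {G H : Germ}
    (e : (f : Germ) = G + (α.bdry : Germ) * H) (hG : Model (α.bdry : Germ) G)
    (hH : Model (β.bdry : Germ) H) :
    ((directSumMap α β (c₁ • modelConj α) (c₂ • modelConj β) f : L2) : Germ)
      = cst c₁ * ((α.bdry : Germ) * star z * star G)
        + (α.bdry : Germ) * (cst c₂ * ((β.bdry : Germ) * star z * star H)) := by
  have hα := α.inner_bdry.1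
  have h1 := coe_proj e hG fun F hF => hF.integral_star_mul hH.1
  have h2 : ((proj β (mulOp (star α.bdry) f) : L2) : Germ) = H := by
    -- Here `ᾱ f = H + ᾱ G`, and `ᾱ G` is orthogonal to all of `H²` because `G ∈ K_α`.
    refine coe_proj (M := star (α.bdry : Germ) * G) ?_ hH fun F hF =>
      hF.1.integral_star_mul ?_
    · unfold Unimodular at hα
      rw [coe_mulOp_star, e]
      linear_combination H * hα
    · rw [star_mul, star_star]
      convert hG.2 using 1
      ring
  rw [directSumMap, AddSubgroup.coe_add, coe_mulOp, Pi.smul_apply, Pi.smul_apply, coe_smul,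
    coe_smul, coe_modelConj, coe_modelConj, h1, h2]

open Classical in
/-- A map of a model space, extended by zero to all functions on the circle. -/
def extendZero {θ : InnerFunction} (C : modelSpace θ →ₗ⋆[ℂ] modelSpace θ) (F : Germ) : Germ :=
  if h : Model (θ.bdry : Germ) F then
    ((C ⟨⟨F, h.1.1⟩, mem_modelSpace_iff.2 h⟩ : L2) : Germ) else 0

lemma extendZero_coe {θ : InnerFunction} (C : modelSpace θ →ₗ⋆[ℂ] modelSpace θ)
    (f : modelSpace θ) : extendZero C ((f : L2) : Germ) = ((C f : L2) : Germ) :=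
  dif_pos (mem_modelSpace_iff.1 f.2)

lemma exists_coe_eq {θ : InnerFunction} {F : Germ} (h : Model (θ.bdry : Germ) F) :
    ∃ f : modelSpace θ, ((f : L2) : Germ) = F :=
  ⟨⟨⟨F, h.1.1⟩, mem_modelSpace_iff.2 h⟩, rfl⟩

lemma gluedConjugation {α θ β : InnerFunction} (hβ : θ.IsQuotient α β)
    {C : modelSpace θ →ₗ⋆[ℂ] modelSpace θ} (hC : IsConjugation C) {C₁ C₂ : L2 →ₗ⋆[ℂ] L2}
    (h₁ : ∀ f : modelSpace θ, (f : L2) ∈ modelSpace α → (C f : L2) = C₁ f)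
    (h₂ : ∀ f : modelSpace θ, (f : L2) ∈ (modelSpace α)ᗮ → (C f : L2) = C₂ f)
    {ψ₁ ψ₂ : Germ} (hψ₁ : ∀ f : L2, ((C₁ f : L2) : Germ) = ψ₁ * star (f : Germ))
    (hψ₂ : ∀ f : L2, ((C₂ f : L2) : Germ) = ψ₂ * star (f : Germ)) :
    GluedConjugation (α.bdry : Germ) (β.bdry : Germ) ψ₁ ψ₂ (extendZero C) := by
  have e := InnerFunction.bdry_eq_mul hβ
  constructor <;> rw [← e]
  · intro F hF
    obtain ⟨f, rfl⟩ := exists_coe_eq hF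
    rw [extendZero_coe]
    exact mem_modelSpace_iff.1 (C f).2
  · intro F hF
    obtain ⟨f, rfl⟩ := exists_coe_eq hF
    rw [extendZero_coe, extendZero_coe, hC.involutive]
  · intro F G hF hG
    obtain ⟨f, rfl⟩ := exists_coe_eq hF
    obtain ⟨g, rfl⟩ := exists_coe_eq hG
    rw [extendZero_coe, extendZero_coe, integral_star_mul_coe, integral_star_mul_coe]
    exact hC.inner_map f g
  · intro F G hF hG
    obtain ⟨f, rfl⟩ := exists_coe_eq hF
    obtain ⟨g, rfl⟩ := exists_coe_eq hG
    rw [extendZero_coe, extendZero_coe]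
    have h := extendZero_coe C (f + g)
    rw [map_add] at h
    exact h
  · intro F hF hF'
    obtain ⟨f, rfl⟩ := exists_coe_eq hF
    rw [extendZero_coe, h₁ f (mem_modelSpace_iff.2 hF'), hψ₁]
  · intro F hF hF'
    obtain ⟨f, rfl⟩ := exists_coe_eq hF
    rw [extendZero_coe, h₂ f (mem_orthogonal_modelSpace_iff.2 hF'), hψ₂]

end ModelSpace

end

/-- Inner functions are taken up to unimodular constant factors, and `C_{c θ} = c C_θ`; this is the
role of the constants `c`, `c₁`, `c₂`. -/
theorem theorem4p5 (α θ β : ModelSpace.InnerFunction)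
    (hα : ¬ α.IsConstant) (hθ : ¬ θ.IsConstant)
    (hβ : θ.IsQuotient α β)
    (C : ModelSpace.modelSpace θ →ₗ⋆[ℂ] ModelSpace.modelSpace θ)
    (hC : ModelSpace.IsConjugation C)
    (C₁ C₂ : ModelSpace.L2 →ₗ⋆[ℂ] ModelSpace.L2)
    (hC₁ : ModelSpace.IsMzConjugation C₁) (hC₂ : ModelSpace.IsMzConjugation C₂)
    (h₁ : ∀ f : ModelSpace.modelSpace θ, (f : ModelSpace.L2) ∈ ModelSpace.modelSpace α →
      (C f : ModelSpace.L2) = C₁ f)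
    (h₂ : ∀ f : ModelSpace.modelSpace θ, (f : ModelSpace.L2) ∈ (ModelSpace.modelSpace α)ᗮ →
      (C f : ModelSpace.L2) = C₂ f) :
    (∃ c : ℂ, ‖c‖ = 1 ∧ ∀ f : ModelSpace.modelSpace θ,
      (C f : ModelSpace.L2) = c • ModelSpace.modelConj θ f) ∨
    (∃ c₁ c₂ : ℂ, ‖c₁‖ = 1 ∧ ‖c₂‖ = 1 ∧ ∀ f : ModelSpace.modelSpace θ,
      (C f : ModelSpace.L2) =
        ModelSpace.directSumMap α β (c₁ • ModelSpace.modelConj α) (c₂ • ModelSpace.modelConj β) f)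
    := by
  obtain ⟨ψ₁, hψ₁, e₁⟩ := hC₁.exists_unimodular
  obtain ⟨ψ₂, hψ₂, e₂⟩ := hC₂.exists_unimodular
  have hA := α.inner_bdry
  have hB := β.inner_bdry
  have e := ModelSpace.InnerFunction.bdry_eq_mul hβ
  rcases (ModelSpace.gluedConjugation hβ hC h₁ h₂ e₁ e₂).classification hA hB hψ₁ hψ₂ with
    ⟨c, hc, h⟩ | ⟨c₁, c₂, hc₁, hc₂, h⟩
  · refine .inl ⟨c, hc, fun f => Subtype.ext ?_⟩
    rw [ModelSpace.coe_smul, ModelSpace.coe_modelConj, e, ← ModelSpace.extendZero_coe]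
    exact h _ (e ▸ ModelSpace.mem_modelSpace_iff.1 f.2)
  · refine .inr ⟨c₁, c₂, hc₁, hc₂, fun f => Subtype.ext ?_⟩
    obtain ⟨G, H, hf, hG, hH⟩ := ModelSpace.Germ.Model.exists_add hA hB
      (e ▸ ModelSpace.mem_modelSpace_iff.1 f.2)
    rw [ModelSpace.coe_directSumMap c₁ c₂ hf hG hH, ← ModelSpace.extendZero_coe, hf]
    exact h G H hG hH
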